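/- Let $\alpha\ge 1$ be real and let $v(z)=0$ for $z<0$, $v(z)=z^{\alpha}$ for $z\ge 0$. For $p>0$, a real number $\delta$ is called a phase shift at $p$ if there is a classical solution $\phi$ of $-\phi''+v\phi=p^2\phi$ on $\mathbf R$ with $\phi(z)\to 0$ as $z\to+\infty$ and $\phi(z)=\sqrt{2/\pi}\,\sin(pz-\delta)$ for $z<0$. For real $E$, let $P_\alpha(\cdot,E)$ denote a nontrivial solution of $\left(-\frac{d^2}{dz^2}+z^\alpha-E\right)P_\alpha(z,E)=0$ on $[0,\infty)$ that vanishes as $z\to\infty$; a prime denotes $d/dz$. Then: 1. For every real $E$, $P_\alpha(\cdot,E)$ exists and is unique up to a nonzero constant factor. For $E=0$ it is, up to a nonzero constant factor, $P_\alpha(z,0)=z^{1/2}K_{\frac1{\alpha+2}}\!\left(\frac{2}{\alpha+2}z^{\frac{\alpha+2}{2}}\right)$ for $z>0$, where $K_\nu$ is the modified Bessel function. 2. For every $p>0$ the set of phase shifts at $p$ is $d+\pi\mathbf Z$ for some $d\in(-\pi/2,\pi/2]$. If $P'_\alpha(0,p^2)\ne0$, then the phase shifts at $p$ are exactly the real $\delta$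 with $\cos\delta\neq 0$ and $$\tan\delta=-p\,\frac{P_\alpha(0,p^2)}{P'_\alpha(0,p^2)};$$ if $P'_\alpha(0,p^2)=0$, they are exactly the real $\delta$ with $\cos\delta=0$. 3. Put $$c_\alpha=(\alpha+2)^{\frac{2}{\alpha+2}}\;\Gamma\!\left(\frac{\alpha+3}{\alpha+2}\right)\Gamma\!\left(\frac{\alpha+1}{\alpha+2}\right)^{-1}.$$ There are $p_0>0$ and $C$ (depending on $\alpha$) such that every phase shift $\delta$ at any $p\in(0,p_0)$ satisfies $|\delta-n\pi-c_\alpha p|\le Cp^3$ for some integer $n$. In particular, for the branch $\delta(p)$ with values in $(-\pi/2,\pi/2]$ for small $p$, $$\delta(p)=c_\alpha\,p+O(p^3)\qquad(p\to0^+).$$ 4. (Airy case, $\alpha=1$.) For every real $E$, $P_1(z,E)\propto\mathrm{Ai}(z-E)$, and $\delta(p)\sim p\,3^{2/3}\,\Gamma(\tfrac43)/\Gamma(\tfrac23)$ as $p\to0^+$, for the same branch. 5. (Parabolic cylinder case, $\alpha=2$.) For every real $E$, $P_2(z,E)\propto D_{\frac12(E-1)}(\sqrt2\,z)$, where $D_\nu$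 is the parabolic cylinder function, and $\delta(p)\sim 2p\,\Gamma(\tfrac54)/\Gamma(\tfrac34)$ as $p\to0^+$, for the same branch. -/

import Mathlib

open Filter Topology Set Asymptotics

noncomputable section

/-- The soft-wall potential on the line (length and energy scales equal to one): it vanishes on
the left half-line and equals `z ^ α` on the right half-line. -/
def powerWall (α z : ℝ) : ℝ := if z < 0 then 0 else z ^ α

/-- `P` (with derivative `P'`) is a nontrivial classical solution of
`-P'' + z ^ α P = E P` on the half-line `[0, ∞)` that vanishes as `z → ∞`.
At the end point `0` the derivatives are one-sided; values at negative `z` play no role. -/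
structure IsDecayingSolution (α E : ℝ) (P P' : ℝ → ℝ) : Prop where
  hasDeriv : ∀ z : ℝ, 0 ≤ z → HasDerivWithinAt P (P' z) (Ici 0) z
  hasDeriv' : ∀ z : ℝ, 0 ≤ z → HasDerivWithinAt P' ((z ^ α - E) * P z) (Ici 0) z
  vanishes : Tendsto P atTop (𝓝 0)
  nontrivial : ∃ z : ℝ, 0 ≤ z ∧ P z ≠ 0

/-- `φ` is an eigenfunction of `-d²/dz² + v` on the whole line for the value `p ^ 2`, with `v` the
soft-wall potential: a classical solution, vanishing as `z → ∞`, that for `z < 0` has the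
normalized form `√(2/π) sin (p z - d)`, with phase shift `d`. -/
structure IsEigenfunction (α p d : ℝ) (φ : ℝ → ℝ) : Prop where
  differentiable : Differentiable ℝ φ
  equation : ∀ z : ℝ, HasDerivAt (deriv φ) ((powerWall α z - p ^ 2) * φ z) z
  vanishes : Tendsto φ atTop (𝓝 0)
  left_form : ∀ z : ℝ, z < 0 → φ z = √(2 / Real.pi) * Real.sin (p * z - d)

/-- `d` is a phase shift (a real number, determined modulo `π`) of the soft wall at momentum `p`. -/
def IsPhaseShift (α p d : ℝ) : Prop := ∃ φ : ℝ → ℝ, IsEigenfunction α p d φ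

/-- The modified Bessel function `K_ν(x)`, for `x > 0`:
`K_ν(x) = ∫₀^∞ exp(-x cosh t) cosh(ν t) dt`. -/
def besselK (ν x : ℝ) : ℝ :=
  ∫ t in Ioi (0 : ℝ), Real.exp (-x * Real.cosh t) * Real.cosh (ν * t)

/-- The Airy function `Ai(x) = (2πi)⁻¹ ∫ exp(t³/3 - x t) dt`, the contour running from
`∞ e^{-iπ/3}` to `∞ e^{iπ/3}`, here taken along the two rays `t = r e^{±iπ/3}`, `r ≥ 0`
(on which `t³ = -r³`); the two rays contribute complex conjugate amounts. -/
def airyAi (x : ℝ) : ℝ :=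
  1 / Real.pi * (∫ r in Ioi (0 : ℝ),
    Complex.exp (Complex.I * (Real.pi / 3)) *
      Complex.exp (-(r : ℂ) ^ 3 / 3 - x * (r * Complex.exp (Complex.I * (Real.pi / 3))))).im

/-- The parabolic cylinder function `D_ν(x)` (Whittaker's notation) for real `ν` and `x`:
`D_ν(x) = e^{x²/4} / Γ(n - ν) ∫₀^∞ t^{n-ν-1} He_n(x + t) e^{-(x+t)²/2} dt`, where `n > ν` is a
natural number (the value does not depend on it; `n = ⌊ν⌋₊ + 1` is used here), and `He_n` is the
`n`-th probabilists' Hermite polynomial, so that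
`He_n(s) e^{-s²/2} = (-d/ds)^n e^{-s²/2}`.
For `ν < 0`, integrating by parts `n` times turns this into the familiar
`D_ν(x) = e^{-x²/4} / Γ(-ν) ∫₀^∞ t^{-ν-1} e^{-t²/2 - x t} dt`, whose analytic continuation in `ν`
it is; `D_0(x) = e^{-x²/4}`. -/
def parabolicCylinderD (ν x : ℝ) : ℝ :=
  Real.exp (x ^ 2 / 4) / Real.Gamma ((⌊ν⌋₊ + 1 : ℕ) - ν) *
    ∫ t in Ioi (0 : ℝ), t ^ (((⌊ν⌋₊ + 1 : ℕ) : ℝ) - ν - 1) *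
      (Polynomial.aeval (x + t) (Polynomial.hermite (⌊ν⌋₊ + 1)) *
        Real.exp (-(x + t) ^ 2 / 2))

/-- The coefficient `(α+2)^{2/(α+2)} Γ((α+3)/(α+2)) / Γ((α+1)/(α+2))`. -/
def phaseSlope (α : ℝ) : ℝ :=
  (α + 2) ^ (2 / (α + 2)) * Real.Gamma ((α + 3) / (α + 2)) / Real.Gamma ((α + 1) / (α + 2))

/-- `δ` is the principal branch of the phase shift for all sufficiently small `p > 0`: the branch
with values in `(-π/2, π/2]`. -/
def IsPrincipalPhaseShift (α : ℝ) (δ : ℝ → ℝ) : Prop :=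
  ∀ᶠ p in 𝓝[>] (0 : ℝ),
    IsPhaseShift α p (δ p) ∧ δ p ∈ Ioc (-(Real.pi / 2)) (Real.pi / 2)

end

/-! Everything reduces to the Cauchy data at `0` of the decaying solution `P`. An eigenfunction is
the given sine on the left and a multiple of `P` (at energy `p²`) on the right; matching value and
slope at `0` amounts to `sin d · P'(0) + cos d · p P(0) = 0` (`isPhaseShift_iff`). As `(P(0), P'(0))
≠ 0`, this fixes `d` modulo `π`.

Existence of `P` is shown where the coefficient is at least `1`: the quotient `w/u` of two solutions
has a limit `L`, and `L u - w` decays (`exists_decaying_solution`). For uniqueness, decaying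
solutions have bounded slope, so their Wronskian tends to `0`; at equal energies it is also
constant, hence zero.

For small `p` one needs `m(E) = -P(0)/P'(0)` near `E = 0`. Differentiability in `E` is avoided. For
`E ≤ 1/256` a function `P P' + g P²` has derivative at least `P²/512` (`exists_energy`) and is
asymptotically at most `P² → 0`. So it is nonpositive at `0`, which gives `0 ≤ m ≤ 16`. It also
dominates the derivative `E P Q` of the Wronskian with the zero-energy solution `Q`, which gives
`|m(E) - m(0)| ≤ 8192 E`. Since `tan d = p m(p²)`, it follows that `d = m(0) p + O(p³)` modulo `π`.

The value `m(0)` comes from an explicit zero-energy solution, the integral `∫ s^(ν-1) exp(-s - y/s)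
ds` with `ν = 1/(α+2)` and `y = ν² z^(1/ν)`: it is a Bessel function in disguise, and its limits at
`0` are Gamma values (`ratio_eq_phaseSlope`). The Airy and parabolic cylinder claims follow by
differentiating the integral representations under the integral sign and integrating by parts once.
-/

/-! ### Linear second-order equations -/

section LinearODE

variable {V : Type*} [NormedAddCommGroup V] [NormedSpace ℝ V]

/-- The terms of the Picard series of the linear equation `x' = A x`, `x t₀ = x₀`. -/
noncomputable def picardTerm (A : ℝ → V →L[ℝ] V) (t₀ : ℝ) (x₀ : V) : ℕ → ℝ → V
  | 0 => fun _ => x₀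
  | n + 1 => fun t => ∫ s in t₀..t, A s (picardTerm A t₀ x₀ n s)

theorem continuous_picardTerm {A : ℝ → V →L[ℝ] V} (hA : Continuous A) (t₀ : ℝ) (x₀ : V) (n : ℕ) :
    Continuous (picardTerm A t₀ x₀ n) := by
  induction n with
  | zero => exact continuous_const
  | succ n ih =>
    exact intervalIntegral.continuous_primitive
      (fun a b => (hA.clm_apply ih).intervalIntegrable a b) t₀

theorem norm_picardTerm_le {A : ℝ → V →L[ℝ] V} (hA : Continuous A) (t₀ : ℝ) (x₀ : V)
    {T M : ℝ} (hM : 0 ≤ M) (hAM : ∀ s, |s - t₀| ≤ T → ‖A s‖ ≤ M) (n : ℕ) :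
    ∀ t, |t - t₀| ≤ T → ‖picardTerm A t₀ x₀ n t‖ ≤ ‖x₀‖ * (M ^ n * |t - t₀| ^ n / n.factorial) := by
  induction n with
  | zero => intro t _; simp [picardTerm]
  | succ n ih =>
    intro t ht
    have hc := continuous_picardTerm hA t₀ x₀ n
    rw [picardTerm, intervalIntegral.norm_intervalIntegral_eq]
    have hbound : ∀ s ∈ uIoc t₀ t, ‖A s (picardTerm A t₀ x₀ n s)‖ ≤
        ‖x₀‖ * M ^ (n + 1) / n.factorial * |s - t₀| ^ n := by
      intro s hs
      have hs' : |s - t₀| ≤ T := (abs_sub_left_of_mem_uIcc (uIoc_subset_uIcc hs)).trans ht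
      calc ‖A s (picardTerm A t₀ x₀ n s)‖ ≤ ‖A s‖ * ‖picardTerm A t₀ x₀ n s‖ :=
            (A s).le_opNorm _
        _ ≤ M * (‖x₀‖ * (M ^ n * |s - t₀| ^ n / n.factorial)) := by
            gcongr
            · exact hAM s hs'
            · exact ih s hs'
        _ = _ := by ring
    refine (MeasureTheory.norm_integral_le_of_norm_le ?_
      ((MeasureTheory.ae_restrict_iff' measurableSet_uIoc).2 (MeasureTheory.ae_of_all _ hbound))).trans ?_
    · have : Continuous fun s => ‖x₀‖ * M ^ (n + 1) / n.factorial * |s - t₀| ^ n := by fun_prop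
      exact (this.intervalIntegrable t₀ t).def'
    · rw [MeasureTheory.integral_const_mul, integral_pow_abs_sub_uIoc, Nat.factorial_succ]
      push_cast
      apply le_of_eq
      field_simp

/-- Linearity makes the Picard series converge globally: its terms are bounded by those of an
exponential series on every ball around `t₀`. The series of derivatives is `A` applied to the same
series, so it converges uniformly there and termwise differentiation is allowed. -/
theorem exists_hasDerivAt_linear [CompleteSpace V] {A : ℝ → V →L[ℝ] V} (hA : Continuous A)
    (t₀ : ℝ) (x₀ : V) :
    ∃ x : ℝ → V, x t₀ = x₀ ∧ ∀ t, HasDerivAt x (A t (x t)) t := by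
  have hc := continuous_picardTerm hA t₀ x₀
  have hd : ∀ n t, HasDerivAt (picardTerm A t₀ x₀ (n + 1)) (A t (picardTerm A t₀ x₀ n t)) t :=
    fun n t => ((hA.clm_apply (hc n)).integral_hasStrictDerivAt t₀ t).hasDerivAt
  have h0 : ∀ n, picardTerm A t₀ x₀ (n + 1) t₀ = 0 := fun n => by simp [picardTerm]
  have key : ∀ T : ℝ, 0 < T → ∃ M : ℝ, 0 ≤ M ∧ ∀ s, |s - t₀| ≤ T → ‖A s‖ ≤ M := by
    intro T hT
    obtain ⟨M, hM⟩ := (isCompact_closedBall t₀ T).exists_bound_of_continuousOn hA.continuousOn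
    refine ⟨max M 0, le_max_right _ _, fun s hs => (hM s ?_).trans (le_max_left _ _)⟩
    simpa [Real.dist_eq] using hs
  have hsum : ∀ t, Summable fun n => picardTerm A t₀ x₀ n t := by
    intro t
    obtain ⟨M, hM, hAM⟩ := key (|t - t₀| + 1) (by positivity)
    refine Summable.of_norm_bounded (((Real.summable_pow_div_factorial (M * |t - t₀|))).mul_left
      ‖x₀‖) fun n => ?_
    have := norm_picardTerm_le hA t₀ x₀ hM hAM n t (by linarith)
    rwa [← mul_pow] at this
  refine ⟨fun t => ∑' n, picardTerm A t₀ x₀ n t, ?_, fun t => ?_⟩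
  · beta_reduce
    rw [tsum_eq_single 0]
    · rfl
    · intro n hn
      obtain ⟨m, rfl⟩ := Nat.exists_eq_succ_of_ne_zero hn
      exact h0 m
  · have hfun : (fun t => ∑' n, picardTerm A t₀ x₀ n t) =
        fun t => x₀ + ∑' n, picardTerm A t₀ x₀ (n + 1) t := by
      ext t
      rw [(hsum t).tsum_eq_zero_add]
      rfl
    have hval : A t (∑' n, picardTerm A t₀ x₀ n t) = ∑' n, A t (picardTerm A t₀ x₀ n t) :=
      (A t).map_tsum (hsum t)
    beta_reduce
    rw [hfun, hval]
    refine HasDerivAt.const_add x₀ ?_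
    set T := |t - t₀| + 1 with hT
    obtain ⟨M, hM, hAM⟩ := key T (by positivity)
    have hu : Summable fun n : ℕ => M * (‖x₀‖ * ((M * T) ^ n / n.factorial)) :=
      ((Real.summable_pow_div_factorial (M * T)).mul_left ‖x₀‖).mul_left M
    refine hasDerivAt_tsum_of_isPreconnected (t := Metric.ball t₀ T) (y₀ := t₀) hu
      Metric.isOpen_ball (convex_ball t₀ T).isPreconnected (fun n s _ => hd n s) ?_
      (Metric.mem_ball_self (by positivity)) ?_ ?_
    · intro n s hs
      have hs' : |s - t₀| ≤ T := by
        have := Metric.mem_ball.1 hs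
        rw [Real.dist_eq] at this
        exact this.le
      refine ((A s).le_opNorm _).trans ?_
      gcongr
      · exact hAM s hs'
      · refine (norm_picardTerm_le hA t₀ x₀ hM hAM n s hs').trans ?_
        rw [← mul_pow]
        gcongr
    · simp only [h0]
      exact summable_zero
    · rw [Metric.mem_ball, Real.dist_eq, hT]
      linarith

end LinearODE

theorem exists_solution_second_order {q : ℝ → ℝ} (hq : Continuous q) (t₀ a b : ℝ) :
    ∃ u u' : ℝ → ℝ, u t₀ = a ∧ u' t₀ = b ∧ (∀ t, HasDerivAt u (u' t) t) ∧
      ∀ t, HasDerivAt u' (q t * u t) t := by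
  let A : ℝ → (ℝ × ℝ) →L[ℝ] (ℝ × ℝ) := fun t =>
    (ContinuousLinearMap.inl ℝ ℝ ℝ).comp (ContinuousLinearMap.snd ℝ ℝ ℝ) +
      q t • (ContinuousLinearMap.inr ℝ ℝ ℝ).comp (ContinuousLinearMap.fst ℝ ℝ ℝ)
  have hA : Continuous A := by fun_prop
  obtain ⟨x, hx0, hx⟩ := exists_hasDerivAt_linear hA t₀ (a, b)
  refine ⟨fun t => (x t).1, fun t => (x t).2, by simp [hx0], by simp [hx0], fun t => ?_,
    fun t => ?_⟩
  · have h := (hasFDerivAt_fst (𝕜 := ℝ) (p := x t)).comp_hasDerivAt t (hx t)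
    refine h.congr_deriv ?_
    simp [A]
  · have h := (hasFDerivAt_snd (𝕜 := ℝ) (p := x t)).comp_hasDerivAt t (hx t)
    refine h.congr_deriv ?_
    simp [A]

/-- Grönwall's inequality for the pair `(f, f')` in the sup norm, with `q` bounded on `[a, z]`. -/
theorem eq_zero_of_second_order {q f f' : ℝ → ℝ} {a : ℝ} (hq : ContinuousOn q (Ici a))
    (hf : ∀ z, a ≤ z → HasDerivWithinAt f (f' z) (Ici a) z)
    (hf' : ∀ z, a ≤ z → HasDerivWithinAt f' (q z * f z) (Ici a) z)
    (h0 : f a = 0) (h0' : f' a = 0) : ∀ z, a ≤ z → f z = 0 ∧ f' z = 0 := by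
  intro z hz
  obtain ⟨M, hM⟩ := (isCompact_Icc (a := a) (b := z)).exists_bound_of_continuousOn
    (hq.mono Icc_subset_Ici_self)
  have key := eq_zero_of_abs_deriv_le_mul_abs_self_of_eq_zero_right
    (f := fun t => (f t, f' t)) (f' := fun t => (f' t, q t * f t)) (K := max M 1) (a := a) (b := z)
    (fun t ht => ((hf t ht.1).continuousWithinAt.mono Icc_subset_Ici_self).prodMk
      ((hf' t ht.1).continuousWithinAt.mono Icc_subset_Ici_self))
    (fun t ht => ((hf t ht.1).mono (Ici_subset_Ici.2 ht.1)).prodMk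
      ((hf' t ht.1).mono (Ici_subset_Ici.2 ht.1))) (by simp [h0, h0']) (by
      intro t ht
      have h1 := hM t ⟨ht.1, ht.2.le⟩
      rw [Prod.norm_def, Prod.norm_def]
      simp only [norm_mul]
      apply max_le
      · calc ‖f' t‖ ≤ max ‖f t‖ ‖f' t‖ := le_max_right _ _
          _ ≤ max M 1 * max ‖f t‖ ‖f' t‖ :=
            le_mul_of_one_le_left (le_max_of_le_left (norm_nonneg _)) (le_max_right _ _)
      · exact mul_le_mul (h1.trans (le_max_left _ _)) (le_max_left _ _) (norm_nonneg _)
          (zero_le_one.trans (le_max_right _ _)))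
    z (right_mem_Icc.2 hz)
  exact ⟨congrArg Prod.fst key, congrArg Prod.snd key⟩

/-! ### Decaying solutions beyond the turning points -/

theorem monotoneOn_Ici_of_hasDerivAt {F F' : ℝ → ℝ} {a : ℝ} (hc : ContinuousOn F (Ici a))
    (hd : ∀ z, a < z → HasDerivAt F (F' z) z) (h0 : ∀ z, a < z → 0 ≤ F' z) :
    MonotoneOn F (Ici a) := by
  refine monotoneOn_of_deriv_nonneg (convex_Ici a) hc ?_ ?_
  · rw [interior_Ici]
    exact fun z hz => (hd z hz).differentiableAt.differentiableWithinAt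
  · rw [interior_Ici]
    intro z hz
    rw [(hd z hz).deriv]
    exact h0 z hz

theorem monotoneOn_Ioi_of_hasDerivAt {F F' : ℝ → ℝ} {a : ℝ}
    (hd : ∀ z, a < z → HasDerivAt F (F' z) z) (h0 : ∀ z, a < z → 0 ≤ F' z) :
    MonotoneOn F (Ioi a) := by
  intro x hx y hy hxy
  refine monotoneOn_Ici_of_hasDerivAt (a := x) (F' := F')
    (fun z hz => (hd z (lt_of_lt_of_le hx hz)).continuousAt.continuousWithinAt)
    (fun z hz => hd z (lt_trans hx hz)) (fun z hz => h0 z (lt_trans hx hz))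
    self_mem_Ici hxy hxy

theorem antitoneOn_Ioi_of_hasDerivAt {F F' : ℝ → ℝ} {a : ℝ}
    (hd : ∀ z, a < z → HasDerivAt F (F' z) z) (h0 : ∀ z, a < z → F' z ≤ 0) :
    AntitoneOn F (Ioi a) := by
  have := monotoneOn_Ioi_of_hasDerivAt (fun z hz => (hd z hz).neg)
    (fun z hz => neg_nonneg.2 (h0 z hz))
  exact fun x hx y hy hxy => neg_le_neg_iff.1 (this hx hy hxy)

/-- `f` (with derivative `f'`) solves `f'' = q f` on the open half-line `(a, ∞)`. -/
structure IsSolutionBeyond (q f f' : ℝ → ℝ) (a : ℝ) : Prop where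
  hasDerivAt : ∀ z, a < z → HasDerivAt f (f' z) z
  hasDerivAt' : ∀ z, a < z → HasDerivAt f' (q z * f z) z

namespace IsSolutionBeyond

variable {q r f f' g g' : ℝ → ℝ} {a : ℝ}

theorem mono {b : ℝ} (h : IsSolutionBeyond q f f' a) (hab : a ≤ b) :
    IsSolutionBeyond q f f' b :=
  ⟨fun z hz => h.hasDerivAt z (hab.trans_lt hz), fun z hz => h.hasDerivAt' z (hab.trans_lt hz)⟩

/-- The derivative of `f f'` is `f'² + q f² ≥ 0`. If `f f'` reached a value `c > 0`, then `f²` would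
grow at rate at least `2c` from there on, against `f → 0`. -/
theorem mul_deriv_nonpos (h : IsSolutionBeyond q f f' a) (hq : ∀ z, a < z → 0 ≤ q z)
    (hf : Tendsto f atTop (𝓝 0)) {z : ℝ} (hz : a < z) : f z * f' z ≤ 0 := by
  by_contra! hc
  set c := f z * f' z with hcdef
  have hmono : MonotoneOn (fun y => f y * f' y) (Ioi a) :=
    monotoneOn_Ioi_of_hasDerivAt
      (fun y hy => (h.hasDerivAt y hy).mul (h.hasDerivAt' y hy)) fun y hy => by
        have := hq y hy
        nlinarith [mul_nonneg this (mul_self_nonneg (f y)), mul_self_nonneg (f' y)]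
  have hmono2 : MonotoneOn (fun y => f y * f y - 2 * c * y) (Ici z) := by
    refine monotoneOn_Ici_of_hasDerivAt
      (F' := fun y => f' y * f y + f y * f' y - 2 * c * 1) ?_ ?_ ?_
    · intro y hy
      have := (h.hasDerivAt y (hz.trans_le hy)).continuousAt
      exact (ContinuousAt.sub (this.mul this) (by fun_prop)).continuousWithinAt
    · intro y hy
      have hy' := h.hasDerivAt y (hz.trans hy)
      exact (hy'.mul hy').sub ((hasDerivAt_id y).const_mul (2 * c))
    · intro y hy
      have : c ≤ f y * f' y := hmono hz (hz.trans hy) (le_of_lt hy)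
      nlinarith
  have hlim : Tendsto (fun y => f y * f y) atTop (𝓝 0) := by simpa using hf.mul hf
  -- After a length `1 / (2c)` the growth at rate `2c` forces `f² ≥ 1`, while `f² < 1` eventually.
  obtain ⟨y, hy1, hy2⟩ := ((hlim.eventually (gt_mem_nhds (zero_lt_one' ℝ))).and
    (eventually_ge_atTop (z + 1 / (2 * c)))).exists
  have hzy : z ≤ y := le_trans (by simp; positivity) hy2
  have h1 : f z * f z - 2 * c * z ≤ f y * f y - 2 * c * y := hmono2 self_mem_Ici hzy hzy
  have h2 : 1 ≤ 2 * c * (y - z) := by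
    have : 1 / (2 * c) ≤ y - z := by linarith
    rwa [div_le_iff₀' (by positivity)] at this
  nlinarith [mul_self_nonneg (f z)]

/-- The derivative of `f'²` is `2 q f f' ≤ 0`. The resulting bound on the slope is what makes
Wronskians of decaying solutions tend to `0`. -/
theorem abs_deriv_le (h : IsSolutionBeyond q f f' a) (hq : ∀ z, a < z → 0 ≤ q z)
    (hf : Tendsto f atTop (𝓝 0)) {y z : ℝ} (hy : a < y) (hyz : y ≤ z) : |f' z| ≤ |f' y| := by
  have hanti : AntitoneOn (fun y => f' y * f' y) (Ioi a) :=
    antitoneOn_Ioi_of_hasDerivAt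
      (fun y hy => (h.hasDerivAt' y hy).mul (h.hasDerivAt' y hy)) fun y hy => by
        nlinarith [mul_nonneg (hq y hy) (neg_nonneg.2 (h.mul_deriv_nonpos hq hf hy))]
  refine sq_le_sq.1 ?_
  simpa [sq] using hanti hy (hy.trans_le hyz) hyz

theorem tendsto_wronskian (hf : IsSolutionBeyond q f f' a) (hg : IsSolutionBeyond r g g' a)
    (hq : ∀ z, a < z → 0 ≤ q z) (hr : ∀ z, a < z → 0 ≤ r z)
    (hf0 : Tendsto f atTop (𝓝 0)) (hg0 : Tendsto g atTop (𝓝 0)) :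
    Tendsto (fun z => f z * g' z - f' z * g z) atTop (𝓝 0) := by
  have hlim : Tendsto (fun z => |f z| * |g' (a + 1)| + |f' (a + 1)| * |g z|) atTop (𝓝 0) := by
    simpa using (hf0.abs.mul_const |g' (a + 1)|).add (hg0.abs.const_mul |f' (a + 1)|)
  refine squeeze_zero_norm' ?_ hlim
  filter_upwards [eventually_ge_atTop (a + 1)] with z hz
  rw [Real.norm_eq_abs]
  refine (abs_sub _ _).trans ?_
  rw [abs_mul, abs_mul]
  exact add_le_add
    (mul_le_mul_of_nonneg_left (hg.abs_deriv_le hr hg0 (by linarith) hz) (abs_nonneg _))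
    (mul_le_mul_of_nonneg_right (hf.abs_deriv_le hq hf0 (by linarith) hz) (abs_nonneg _))

theorem hasDerivAt_wronskian (hf : IsSolutionBeyond q f f' a) (hg : IsSolutionBeyond r g g' a)
    {z : ℝ} (hz : a < z) :
    HasDerivAt (fun z => f z * g' z - f' z * g z) ((r z - q z) * (f z * g z)) z := by
  refine (((hf.hasDerivAt z hz).mul (hg.hasDerivAt' z hz)).sub
    ((hf.hasDerivAt' z hz).mul (hg.hasDerivAt z hz))).congr_deriv ?_
  ring

theorem wronskian_eq_zero (hf : IsSolutionBeyond q f f' a) (hg : IsSolutionBeyond q g g' a)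
    (hq : ∀ᶠ z in atTop, 0 ≤ q z)
    (hf0 : Tendsto f atTop (𝓝 0)) (hg0 : Tendsto g atTop (𝓝 0)) {z : ℝ} (hz : a < z) :
    f z * g' z - f' z * g z = 0 := by
  obtain ⟨b, hb⟩ := eventually_atTop.1 hq
  have hlim := (hf.mono (le_max_left a b)).tendsto_wronskian (hg.mono (le_max_left a b))
    (fun z hz => hb z ((le_max_right a b).trans hz.le))
    (fun z hz => hb z ((le_max_right a b).trans hz.le)) hf0 hg0
  have hd : ∀ y, a < y → HasDerivAt (fun z => f z * g' z - f' z * g z) 0 y := fun y hy =>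
    (hf.hasDerivAt_wronskian hg hy).congr_deriv (by ring)
  refine tendsto_nhds_unique (tendsto_const_nhds.congr' ?_) hlim
  filter_upwards [eventually_ge_atTop z] with y hy
  exact le_antisymm
    (monotoneOn_Ioi_of_hasDerivAt hd (fun _ _ => le_rfl) hz (hz.trans_le hy) hy)
    (antitoneOn_Ioi_of_hasDerivAt hd (fun _ _ => le_rfl) hz (hz.trans_le hy) hy)

end IsSolutionBeyond

/-- Both `u u'` and `u²` increase, so `u² ≥ 1`; `u` starts at `1` and cannot change sign, so `u ≥
1`. Then `u'' = q u ≥ 1` gives linear growth of the slope. -/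
theorem exists_growing_solution {q : ℝ → ℝ} (hq : Continuous q) {z₀ : ℝ}
    (hq1 : ∀ z, z₀ ≤ z → 1 ≤ q z) :
    ∃ u u' : ℝ → ℝ, u z₀ = 1 ∧ u' z₀ = 0 ∧ (∀ t, HasDerivAt u (u' t) t) ∧
      (∀ t, HasDerivAt u' (q t * u t) t) ∧ ∀ z, z₀ ≤ z → 1 ≤ u z ∧ z - z₀ ≤ u' z := by
  obtain ⟨u, u', h1, h0, hu, hu'⟩ := exists_solution_second_order hq z₀ 1 0
  have hcu : Continuous u := continuous_iff_continuousAt.2 fun t => (hu t).continuousAt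
  have hcu' : Continuous u' := continuous_iff_continuousAt.2 fun t => (hu' t).continuousAt
  have huu' : ∀ z, z₀ ≤ z → 0 ≤ u z * u' z := by
    intro z hz
    have := monotoneOn_Ici_of_hasDerivAt (a := z₀) (hcu.mul hcu').continuousOn
      (fun y _ => (hu y).mul (hu' y)) (fun y hy => by
        have := hq1 y (le_of_lt hy)
        nlinarith [mul_nonneg (zero_le_one.trans this) (mul_self_nonneg (u y)),
          mul_self_nonneg (u' y)]) self_mem_Ici hz hz
    simpa [h0] using this
  have husq : ∀ z, z₀ ≤ z → 1 ≤ u z * u z := by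
    intro z hz
    have := monotoneOn_Ici_of_hasDerivAt (a := z₀) (hcu.mul hcu).continuousOn
      (fun y _ => (hu y).mul (hu y)) (fun y hy => by
        have := huu' y (le_of_lt hy)
        nlinarith) self_mem_Ici hz hz
    simpa [h1] using this
  have hu1 : ∀ z, z₀ ≤ z → 1 ≤ u z := by
    intro z hz
    by_contra! hlt
    have hneg : u z ≤ 0 := by nlinarith [husq z hz]
    obtain ⟨y, hy, hy0⟩ := intermediate_value_Icc' hz hcu.continuousOn
      (show (0 : ℝ) ∈ Icc (u z) (u z₀) by simp [h1, hneg])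
    have := husq y hy.1
    rw [hy0] at this
    norm_num at this
  refine ⟨u, u', h1, h0, hu, hu', fun z hz => ⟨hu1 z hz, ?_⟩⟩
  have := monotoneOn_Ici_of_hasDerivAt (a := z₀) (F := fun y => u' y - y)
    (hcu'.sub continuous_id).continuousOn (fun y _ => (hu' y).sub (hasDerivAt_id y))
    (fun y hy => by
      nlinarith [hq1 y (le_of_lt hy), hu1 y (le_of_lt hy)]) self_mem_Ici hz hz
  simp only [h0] at this
  linarith

/-- With `u` growing and `w` of Wronskian `1` against it, `w/u` has derivative `1/u²` and increases,
while `w/u + 1/(u u')` has derivative `-q/u'²` and decreases. For `L = sup w/u` this squeezes `L u -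
w` between `0` and `1/u' ≤ 1/(z - z₀)`. The slope `-1` at `z₀` certifies nontriviality later. -/
theorem exists_decaying_solution {q : ℝ → ℝ} (hq : Continuous q) {z₀ : ℝ}
    (hq1 : ∀ z, z₀ ≤ z → 1 ≤ q z) :
    ∃ f f' : ℝ → ℝ, (∀ t, HasDerivAt f (f' t) t) ∧ (∀ t, HasDerivAt f' (q t * f t) t) ∧
      Tendsto f atTop (𝓝 0) ∧ f' z₀ = -1 := by
  obtain ⟨u, u', hu1, hu0, hu, hu', hpos⟩ := exists_growing_solution hq hq1
  obtain ⟨w, w', hw0, hw1, hw, hw'⟩ := exists_solution_second_order hq z₀ 0 1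
  have hcu : Continuous u := continuous_iff_continuousAt.2 fun t => (hu t).continuousAt
  have hcu' : Continuous u' := continuous_iff_continuousAt.2 fun t => (hu' t).continuousAt
  have hcw : Continuous w := continuous_iff_continuousAt.2 fun t => (hw t).continuousAt
  have hcw' : Continuous w' := continuous_iff_continuousAt.2 fun t => (hw' t).continuousAt
  have hW : ∀ z, z₀ ≤ z → u z * w' z - u' z * w z = 1 := by
    intro z hz
    have hd : ∀ y, z₀ < y → HasDerivAt (fun y => u y * w' y - u' y * w y) 0 y := fun y _ =>
      (((hu y).mul (hw' y)).sub ((hu' y).mul (hw y))).congr_deriv (by ring)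
    have hc : Continuous fun y => u y * w' y - u' y * w y := by fun_prop
    have h1 := monotoneOn_Ici_of_hasDerivAt hc.continuousOn hd (fun _ _ => le_rfl)
      self_mem_Ici hz hz
    have h2 := monotoneOn_Ici_of_hasDerivAt hc.neg.continuousOn
      (fun y hy => (hd y hy).neg) (fun _ _ => by simp) self_mem_Ici hz hz
    simp only [hu1, hu0, hw0, hw1, Pi.neg_apply] at h1 h2
    linarith
  have hu'pos : ∀ z, z₀ < z → 0 < u' z := fun z hz => by linarith [(hpos z hz.le).2]
  have hupos : ∀ z, z₀ < z → 0 < u z := fun z hz => by linarith [(hpos z hz.le).1]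
  have hlow : MonotoneOn (fun z => w z / u z) (Ioi z₀) := by
    refine monotoneOn_Ioi_of_hasDerivAt
      (fun z hz => (hw z).div (hu z) (hupos z hz).ne') fun z hz => ?_
    have : w' z * u z - w z * u' z = 1 := by linarith [hW z hz.le]
    rw [this]
    positivity
  have hup : AntitoneOn (fun z => w z / u z + (u z * u' z)⁻¹) (Ioi z₀) := by
    refine antitoneOn_Ioi_of_hasDerivAt
      (fun z hz => ((hw z).div (hu z) (hupos z hz).ne').add (((hu z).mul (hu' z)).inv
        (mul_pos (hupos z hz) (hu'pos z hz)).ne')) fun z hz => ?_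
    have h1 : w' z * u z - w z * u' z = 1 := by linarith [hW z hz.le]
    have h2 := hupos z hz
    have h3 := hu'pos z hz
    have h4 := hq1 z hz.le
    have h5 : 1 / u z ^ 2 + -(u' z * u' z + u z * (q z * u z)) / (u z * u' z) ^ 2 =
        -(q z / u' z ^ 2) := by
      field_simp
      ring
    rw [h1, Pi.mul_apply, h5, neg_nonpos]
    positivity
  have hle : ∀ x, z₀ < x → ∀ y, z₀ < y → w x / u x ≤ w y / u y + (u y * u' y)⁻¹ := by
    intro x hx y hy
    have hm : z₀ < max x y := lt_max_of_lt_left hx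
    have h1 := hlow hx hm (le_max_left x y)
    have h2 := hup hy hm (le_max_right x y)
    have h3 := mul_pos (hupos _ hm) (hu'pos _ hm)
    simp only at h1 h2
    have := (inv_pos.2 h3).le
    linarith
  set S := (fun z => w z / u z) '' Ioi z₀
  have hne : S.Nonempty := (nonempty_Ioi).image _
  have hLle : ∀ y, z₀ < y → sSup S ≤ w y / u y + (u y * u' y)⁻¹ := fun y hy =>
    csSup_le hne (by rintro _ ⟨x, hx, rfl⟩; exact hle x hx y hy)
  have hbdd : BddAbove S := ⟨w (z₀ + 1) / u (z₀ + 1) + (u (z₀ + 1) * u' (z₀ + 1))⁻¹, by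
    rintro _ ⟨x, hx, rfl⟩
    exact hle x hx _ (by linarith)⟩
  have hleL : ∀ y, z₀ < y → w y / u y ≤ sSup S := fun y hy => le_csSup hbdd ⟨y, hy, rfl⟩
  generalize sSup S = L at hLle hleL
  refine ⟨fun z => L * u z - w z, fun z => L * u' z - w' z,
    fun t => ((hu t).const_mul L).sub (hw t),
    fun t => (((hu' t).const_mul L).sub (hw' t)).congr_deriv (by ring), ?_, by
      simp [hu0, hw1]⟩
  have hlim : Tendsto (fun z => (z - z₀)⁻¹) atTop (𝓝 0) :=
    tendsto_inv_atTop_zero.comp (tendsto_atTop_add_const_right _ _ tendsto_id)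
  refine squeeze_zero' ?_ ?_ hlim
  · filter_upwards [eventually_gt_atTop z₀] with z hz
    have := hleL z hz
    rw [div_le_iff₀ (hupos z hz)] at this
    linarith
  · filter_upwards [eventually_gt_atTop z₀] with z hz
    have h1 := hLle z hz
    have h2 := hupos z hz
    have h3 := hu'pos z hz
    have h4 : L * u z - w z ≤ (u' z)⁻¹ := by
      have h5 := mul_le_mul_of_nonneg_right h1 h2.le
      have h6 : (w z / u z + (u z * u' z)⁻¹) * u z = w z + (u' z)⁻¹ := by field_simp
      linarith
    refine h4.trans ?_
    exact inv_anti₀ (by linarith) (hpos z hz.le).2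

/-! ### Decaying solutions of the power wall -/

theorem one_le_rpow_sub {α E z : ℝ} (hα : 1 ≤ α) (hz : max 1 (E + 1) ≤ z) : 1 ≤ z ^ α - E := by
  have h1 : 1 ≤ z := (le_max_left _ _).trans hz
  have h2 : E + 1 ≤ z := (le_max_right _ _).trans hz
  have h3 := Real.self_le_rpow_of_one_le h1 hα
  linarith

theorem eventually_nonneg_rpow_sub {α : ℝ} (hα : 1 ≤ α) (E : ℝ) :
    ∀ᶠ z : ℝ in atTop, 0 ≤ z ^ α - E := by
  filter_upwards [eventually_ge_atTop (max 1 (E + 1))] with z hz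
  linarith [one_le_rpow_sub hα hz]

/-- For `z < 0` the real power is a convention, but it is continuous there too, so the equation can
be solved on the whole line and restricted. -/
theorem continuous_rpow_sub {α : ℝ} (hα : 1 ≤ α) (E : ℝ) : Continuous fun z : ℝ => z ^ α - E :=
  (Real.continuous_rpow_const (by linarith)).sub continuous_const

theorem exists_isDecayingSolution {α : ℝ} (hα : 1 ≤ α) (E : ℝ) :
    ∃ P P' : ℝ → ℝ, IsDecayingSolution α E P P' := by
  obtain ⟨f, f', hf, hf', hlim, hne⟩ := exists_decaying_solution (continuous_rpow_sub hα E)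
    (fun z hz => one_le_rpow_sub hα hz)
  refine ⟨f, f', fun z _ => (hf z).hasDerivWithinAt, fun z _ => (hf' z).hasDerivWithinAt, hlim, ?_⟩
  by_contra! h
  have hpos : 0 < max 1 (E + 1) := lt_max_of_lt_left one_pos
  have h0 : HasDerivAt f 0 (max 1 (E + 1)) := by
    refine (hasDerivAt_const _ (0 : ℝ)).congr_of_eventuallyEq ?_
    filter_upwards [lt_mem_nhds hpos] with z hz
    exact h z hz.le
  have := (hf _).unique h0
  rw [hne] at this
  norm_num at this

namespace IsDecayingSolution

variable {α E F : ℝ} {P P' Q Q' : ℝ → ℝ}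

theorem isSolutionBeyond (h : IsDecayingSolution α E P P') :
    IsSolutionBeyond (fun z => z ^ α - E) P P' 0 :=
  ⟨fun z hz => (h.hasDeriv z hz.le).hasDerivAt (Ici_mem_nhds hz),
    fun z hz => (h.hasDeriv' z hz.le).hasDerivAt (Ici_mem_nhds hz)⟩

theorem continuousOn (h : IsDecayingSolution α E P P') : ContinuousOn P (Ici 0) :=
  fun z hz => (h.hasDeriv z hz).continuousWithinAt

theorem continuousOn' (h : IsDecayingSolution α E P P') : ContinuousOn P' (Ici 0) :=
  fun z hz => (h.hasDeriv' z hz).continuousWithinAt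

theorem initial_ne_zero (hα : 1 ≤ α) (h : IsDecayingSolution α E P P') (h0 : P 0 = 0) :
    P' 0 ≠ 0 := by
  intro h0'
  obtain ⟨z, hz, hne⟩ := h.nontrivial
  exact hne (eq_zero_of_second_order (continuous_rpow_sub hα E).continuousOn h.hasDeriv h.hasDeriv'
    h0 h0' z hz).1

theorem continuousOn_wronskian (hP : IsDecayingSolution α E P P')
    (hQ : IsDecayingSolution α F Q Q') :
    ContinuousOn (fun z => P z * Q' z - P' z * Q z) (Ici 0) :=
  (hP.continuousOn.mul hQ.continuousOn').sub (hP.continuousOn'.mul hQ.continuousOn)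

theorem tendsto_wronskian (hα : 1 ≤ α) (hP : IsDecayingSolution α E P P')
    (hQ : IsDecayingSolution α F Q Q') :
    Tendsto (fun z => P z * Q' z - P' z * Q z) atTop (𝓝 0) := by
  obtain ⟨b, hb⟩ := eventually_atTop.1
    ((eventually_nonneg_rpow_sub hα E).and (eventually_nonneg_rpow_sub hα F))
  exact (hP.isSolutionBeyond.mono (le_max_left 0 b)).tendsto_wronskian
    (hQ.isSolutionBeyond.mono (le_max_left 0 b))
    (fun z hz => (hb z ((le_max_right 0 b).trans hz.le)).1)
    (fun z hz => (hb z ((le_max_right 0 b).trans hz.le)).2) hP.vanishes hQ.vanishes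

theorem wronskian_zero (hα : 1 ≤ α) (hP : IsDecayingSolution α E P P')
    (hQ : IsDecayingSolution α E Q Q') : P 0 * Q' 0 - P' 0 * Q 0 = 0 := by
  have h : ∀ z, 0 < z → P z * Q' z - P' z * Q z = 0 := fun z hz =>
    hP.isSolutionBeyond.wronskian_eq_zero hQ.isSolutionBeyond (eventually_nonneg_rpow_sub hα E)
      hP.vanishes hQ.vanishes hz
  have hc : Tendsto (fun z => P z * Q' z - P' z * Q z) (𝓝[>] 0) (𝓝 (P 0 * Q' 0 - P' 0 * Q 0)) :=
    (hP.continuousOn_wronskian hQ 0 self_mem_Ici).mono_left (nhdsWithin_mono _ Ioi_subset_Ici_self)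
  refine tendsto_nhds_unique hc (tendsto_const_nhds.congr' ?_)
  filter_upwards [self_mem_nhdsWithin] with z hz
  exact (h z hz).symm

/-- The vanishing Wronskian makes the Cauchy data at `0` proportional, and then `Q - c P` has zero
data there. -/
theorem eq_const_mul (hα : 1 ≤ α) (hP : IsDecayingSolution α E P P')
    (hQ : IsDecayingSolution α E Q Q') :
    ∃ c : ℝ, c ≠ 0 ∧ ∀ z, 0 ≤ z → Q z = c * P z ∧ Q' z = c * P' z := by
  have hW := hP.wronskian_zero hα hQ
  obtain ⟨c, hc0, hc1⟩ : ∃ c : ℝ, Q 0 = c * P 0 ∧ Q' 0 = c * P' 0 := by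
    by_cases h0 : P 0 = 0
    · have h1 := hP.initial_ne_zero hα h0
      refine ⟨Q' 0 / P' 0, ?_, by field_simp⟩
      rw [h0] at hW ⊢
      have : P' 0 * Q 0 = 0 := by linarith
      simpa [h1] using this
    · refine ⟨Q 0 / P 0, by field_simp, ?_⟩
      field_simp
      linarith
  have key := eq_zero_of_second_order (q := fun z => z ^ α - E) (f := fun z => Q z - c * P z)
    (f' := fun z => Q' z - c * P' z) (continuous_rpow_sub hα E).continuousOn
    (fun z hz => (hQ.hasDeriv z hz).sub ((hP.hasDeriv z hz).const_mul c))
    (fun z hz => ((hQ.hasDeriv' z hz).sub ((hP.hasDeriv' z hz).const_mul c)).congr_deriv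
      (by ring)) (by simp [hc0]) (by simp [hc1])
  refine ⟨c, ?_, fun z hz => ⟨sub_eq_zero.1 (key z hz).1, sub_eq_zero.1 (key z hz).2⟩⟩
  rintro rfl
  obtain ⟨z, hz, hne⟩ := hQ.nontrivial
  exact hne (by simpa using (key z hz).1)

end IsDecayingSolution

/-! ### Phase shifts -/

theorem IsEigenfunction.apply_zero {α p d : ℝ} {φ : ℝ → ℝ} (h : IsEigenfunction α p d φ) :
    φ 0 = -(√(2 / Real.pi) * Real.sin d) ∧ deriv φ 0 = √(2 / Real.pi) * (p * Real.cos d) := by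
  have hs : ∀ z, HasDerivAt (fun z => √(2 / Real.pi) * Real.sin (p * z - d))
      (√(2 / Real.pi) * (Real.cos (p * z - d) * (p * 1))) z := fun z =>
    ((((hasDerivAt_id z).const_mul p).sub_const d).sin).const_mul _
  constructor
  · have h1 : Tendsto φ (𝓝[<] 0) (𝓝 (φ 0)) :=
      h.differentiable.continuous.continuousAt.continuousWithinAt
    have h2 : Tendsto (fun z => √(2 / Real.pi) * Real.sin (p * z - d)) (𝓝[<] 0)
        (𝓝 (√(2 / Real.pi) * Real.sin (p * 0 - d))) :=
      (hs 0).continuousAt.continuousWithinAt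
    rw [tendsto_nhds_unique (h1.congr' ?_) h2]
    · simp
    · filter_upwards [self_mem_nhdsWithin] with z hz
      exact h.left_form z hz
  · have h1 : Tendsto (deriv φ) (𝓝[<] 0) (𝓝 (deriv φ 0)) :=
      (h.equation 0).continuousAt.continuousWithinAt
    have h2 : Tendsto (fun z => √(2 / Real.pi) * (Real.cos (p * z - d) * (p * 1))) (𝓝[<] 0)
        (𝓝 (√(2 / Real.pi) * (Real.cos (p * 0 - d) * (p * 1)))) := by
      have : Continuous fun z => √(2 / Real.pi) * (Real.cos (p * z - d) * (p * 1)) := by fun_prop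
      exact this.continuousAt.continuousWithinAt
    rw [tendsto_nhds_unique (h1.congr' ?_) h2]
    · simp [mul_comm]
    · filter_upwards [self_mem_nhdsWithin] with z hz
      refine ((hs z).congr_of_eventuallyEq ?_).deriv
      filter_upwards [gt_mem_nhds (show z < 0 from hz)] with y hy
      exact h.left_form y hy

theorem sqrt_two_div_pi_pos : 0 < √(2 / Real.pi) :=
  Real.sqrt_pos.2 (div_pos two_pos Real.pi_pos)

theorem IsEigenfunction.isDecayingSolution {α p d : ℝ} {φ : ℝ → ℝ} (hp : 0 < p)
    (h : IsEigenfunction α p d φ) : IsDecayingSolution α (p ^ 2) φ (deriv φ) where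
  hasDeriv z _ := (h.differentiable z).hasDerivAt.hasDerivWithinAt
  hasDeriv' z hz := by
    have := h.equation z
    rw [powerWall, if_neg (not_lt.2 hz)] at this
    exact this.hasDerivWithinAt
  vanishes := h.vanishes
  nontrivial := by
    by_contra! h0
    obtain ⟨h1, h2⟩ := h.apply_zero
    have h3 : deriv φ 0 = 0 := by
      have hd : HasDerivWithinAt φ 0 (Ici 0) 0 :=
        (hasDerivWithinAt_const 0 (Ici 0) (0 : ℝ)).congr (fun z hz => h0 z hz) (h0 0 le_rfl)
      exact (uniqueDiffOn_Ici (0 : ℝ) 0 self_mem_Ici).eq_deriv _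
        (h.differentiable 0).hasDerivAt.hasDerivWithinAt hd
    rw [h0 0 le_rfl] at h1
    rw [h3] at h2
    have hs := sqrt_two_div_pi_pos
    have h4 : Real.sin d = 0 :=
      (mul_eq_zero.1 (neg_eq_zero.1 h1.symm)).resolve_left hs.ne'
    have h5 : Real.cos d = 0 :=
      (mul_eq_zero.1 ((mul_eq_zero.1 h2.symm).resolve_left hs.ne')).resolve_left hp.ne'
    simpa [h4, h5] using Real.sin_sq_add_cos_sq d

theorem IsDecayingSolution.isPhaseShift_of_matching {α p d c : ℝ} {P P' : ℝ → ℝ} (hα : 1 ≤ α)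
    (h : IsDecayingSolution α (p ^ 2) P P')
    (h0 : c * P 0 = -(√(2 / Real.pi) * Real.sin d))
    (h1 : c * P' 0 = √(2 / Real.pi) * (p * Real.cos d)) : IsPhaseShift α p d := by
  set K := √(2 / Real.pi) with hK
  let s : ℝ → ℝ := fun z => K * Real.sin (p * z - d)
  let s' : ℝ → ℝ := fun z => K * (p * Real.cos (p * z - d))
  have hs : ∀ z, HasDerivAt s (s' z) z := fun z =>
    (((((hasDerivAt_id z).const_mul p).sub_const d).sin).const_mul K).congr_deriv (by
      simp only [s', mul_one, id]; ring)
  have hs' : ∀ z, HasDerivAt s' (-p ^ 2 * s z) z := fun z =>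
    ((((((hasDerivAt_id z).const_mul p).sub_const d).cos).const_mul p).const_mul K).congr_deriv (by
      simp only [s, mul_one, id]; ring)
  have hs0 : s 0 = c * P 0 := by simp [s, h0]
  have hs0' : s' 0 = c * P' 0 := by simp [s', h1]
  let φ : ℝ → ℝ := fun z => if z < 0 then s z else c * P z
  let ψ : ℝ → ℝ := fun z => if z < 0 then s' z else c * P' z
  -- Gluing rule at `0`, used twice: once for the function and once for its derivative.
  have glue : ∀ (f g f' g' : ℝ → ℝ), (∀ z, HasDerivAt f (f' z) z) →
      (∀ z, 0 ≤ z → HasDerivWithinAt g (g' z) (Ici 0) z) → f 0 = g 0 → f' 0 = g' 0 →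
      ∀ z, HasDerivAt (fun z => if z < 0 then f z else g z) (if z < 0 then f' z else g' z) z := by
    intro f g f' g' hf hg hfg hfg' z
    rcases lt_trichotomy z 0 with hz | rfl | hz
    · rw [if_pos hz]
      refine (hf z).congr_of_eventuallyEq ?_
      filter_upwards [gt_mem_nhds hz] with y hy
      rw [if_pos hy]
    · rw [if_neg (lt_irrefl _), ← hasDerivWithinAt_univ, ← Iic_union_Ici (a := (0 : ℝ))]
      refine HasDerivWithinAt.union ?_ ?_
      · rw [← hfg']
        refine (hf 0).hasDerivWithinAt.congr (fun y hy => ?_) (by simp [hfg])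
        rcases eq_or_lt_of_le (show y ≤ 0 from hy) with rfl | hy
        · simp [hfg]
        · rw [if_pos hy]
      · exact (hg 0 le_rfl).congr (fun y hy => if_neg (not_lt.2 hy)) (if_neg (lt_irrefl _))
    · rw [if_neg hz.le.not_gt]
      refine ((hg z hz.le).hasDerivAt (Ici_mem_nhds hz)).congr_of_eventuallyEq ?_
      filter_upwards [lt_mem_nhds hz] with y hy
      rw [if_neg hy.le.not_gt]
  have hφ : ∀ z, HasDerivAt φ (ψ z) z :=
    glue s (fun z => c * P z) s' (fun z => c * P' z) hs
      (fun z hz => (h.hasDeriv z hz).const_mul c) hs0 hs0'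
  -- The second derivatives match at `0` because the potential is continuous there: `0 ^ α = 0`.
  have hψ : ∀ z, HasDerivAt ψ (if z < 0 then -p ^ 2 * s z else c * ((z ^ α - p ^ 2) * P z)) z :=
    glue s' (fun z => c * P' z) (fun z => -p ^ 2 * s z) (fun z => c * ((z ^ α - p ^ 2) * P z)) hs'
      (fun z hz => (h.hasDeriv' z hz).const_mul c) hs0' (by
        simp only [hs0, Real.zero_rpow (show α ≠ 0 by linarith)]
        ring)
  have hderiv : deriv φ = ψ := funext fun z => (hφ z).deriv
  refine ⟨φ, fun z => (hφ z).differentiableAt, fun z => ?_, ?_, fun z hz => ?_⟩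
  · rw [hderiv]
    refine (hψ z).congr_deriv ?_
    by_cases hz : z < 0
    · simp only [powerWall, φ, if_pos hz]
      ring
    · simp only [powerWall, φ, if_neg hz]
      ring
  · have : Tendsto (fun z => c * P z) atTop (𝓝 0) := by simpa using h.vanishes.const_mul c
    refine this.congr' ?_
    filter_upwards [eventually_ge_atTop 0] with z hz
    simp [φ, not_lt.2 hz]
  · simp [φ, s, if_pos hz, hK]

theorem isPhaseShift_iff {α p d : ℝ} {P P' : ℝ → ℝ} (hα : 1 ≤ α) (hp : 0 < p)
    (h : IsDecayingSolution α (p ^ 2) P P') :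
    IsPhaseShift α p d ↔ Real.sin d * P' 0 + Real.cos d * (p * P 0) = 0 := by
  have hK := sqrt_two_div_pi_pos
  constructor
  · rintro ⟨φ, hφ⟩
    obtain ⟨h0, h1⟩ := hφ.apply_zero
    have hW := h.wronskian_zero hα (hφ.isDecayingSolution hp)
    rw [h0, h1] at hW
    have : √(2 / Real.pi) * (Real.sin d * P' 0 + Real.cos d * (p * P 0)) = 0 := by
      linarith
    exact (mul_eq_zero.1 this).resolve_left hK.ne'
  · intro hd
    set K := √(2 / Real.pi)
    by_cases h0 : P 0 = 0
    · have h1 := h.initial_ne_zero hα h0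
      have hsin : Real.sin d = 0 := by simpa [h0, h1] using hd
      exact h.isPhaseShift_of_matching (c := K * (p * Real.cos d) / P' 0) hα
        (by simp [h0, hsin]) (div_mul_cancel₀ _ h1)
    · refine h.isPhaseShift_of_matching (c := -(K * Real.sin d) / P 0) hα (div_mul_cancel₀ _ h0) ?_
      rw [div_mul_eq_mul_div, div_eq_iff h0]
      linear_combination (-K) * hd

theorem exists_phaseShift_iff {α p : ℝ} (hα : 1 ≤ α) (hp : 0 < p) :
    ∃ d ∈ Ioc (-(Real.pi / 2)) (Real.pi / 2),
      ∀ d' : ℝ, IsPhaseShift α p d' ↔ ∃ n : ℤ, d' = d + n * Real.pi := by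
  obtain ⟨P, P', h⟩ := exists_isDecayingSolution hα (p ^ 2)
  -- In polar form `w = |w| e^{iθ}`, the matching condition becomes `sin (d + θ) = 0`, so the phase
  -- shifts are `-θ + π ℤ`.
  set w : ℂ := ⟨P' 0, p * P 0⟩ with hw
  have hw0 : w ≠ 0 := by
    intro h0
    have h1 : P' 0 = 0 := congrArg Complex.re h0
    have h2 : p * P 0 = 0 := congrArg Complex.im h0
    exact h.initial_ne_zero hα (by simpa [hp.ne'] using h2) h1
  have hn : ‖w‖ ≠ 0 := norm_ne_zero_iff.2 hw0
  have hre : P' 0 = ‖w‖ * Real.cos w.arg := (Complex.norm_mul_cos_arg w).symm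
  have him : p * P 0 = ‖w‖ * Real.sin w.arg := (Complex.norm_mul_sin_arg w).symm
  have key : ∀ d', IsPhaseShift α p d' ↔ ∃ n : ℤ, (n : ℝ) * Real.pi = d' + w.arg := by
    intro d'
    rw [isPhaseShift_iff hα hp h, ← Real.sin_eq_zero_iff, Real.sin_add, hre, him]
    constructor
    · intro h0
      have : ‖w‖ * (Real.sin d' * Real.cos w.arg + Real.cos d' * Real.sin w.arg) = 0 := by
        linarith
      simpa [hn] using this
    · intro h0
      linear_combination ‖w‖ * h0
  refine ⟨toIocMod Real.pi_pos (-(Real.pi / 2)) (-w.arg), ?_, fun d' => ?_⟩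
  · have := toIocMod_mem_Ioc Real.pi_pos (-(Real.pi / 2)) (-w.arg)
    rwa [show -(Real.pi / 2) + Real.pi = Real.pi / 2 by ring] at this
  · have hm := toIocMod_add_toIocDiv_zsmul Real.pi_pos (-(Real.pi / 2)) (-w.arg)
    rw [zsmul_eq_mul] at hm
    set k := toIocDiv Real.pi_pos (-(Real.pi / 2)) (-w.arg)
    rw [key]
    constructor
    · rintro ⟨n, hn⟩
      refine ⟨n + k, ?_⟩
      push_cast
      linarith
    · rintro ⟨n, hn⟩
      refine ⟨n - k, ?_⟩
      push_cast
      linarith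

theorem isPhaseShift_iff_tan {α p d : ℝ} {P P' : ℝ → ℝ} (hα : 1 ≤ α) (hp : 0 < p)
    (h : IsDecayingSolution α (p ^ 2) P P') (h0 : P' 0 ≠ 0) :
    IsPhaseShift α p d ↔ Real.cos d ≠ 0 ∧ Real.tan d = -p * (P 0 / P' 0) := by
  rw [isPhaseShift_iff hα hp h]
  constructor
  · intro hd
    have hc : Real.cos d ≠ 0 := by
      intro hc
      have hs : Real.sin d = 0 := by simpa [hc, h0] using hd
      simpa [hc, hs] using Real.sin_sq_add_cos_sq d
    refine ⟨hc, ?_⟩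
    rw [Real.tan_eq_sin_div_cos, div_eq_iff hc]
    field_simp
    linarith
  · rintro ⟨hc, ht⟩
    rw [Real.tan_eq_sin_div_cos, div_eq_iff hc] at ht
    rw [ht]
    field_simp
    ring

theorem isPhaseShift_iff_cos {α p d : ℝ} {P P' : ℝ → ℝ} (hα : 1 ≤ α) (hp : 0 < p)
    (h : IsDecayingSolution α (p ^ 2) P P') (h0 : P' 0 = 0) :
    IsPhaseShift α p d ↔ Real.cos d = 0 := by
  have h1 : P 0 ≠ 0 := fun h1 => h.initial_ne_zero hα h1 h0
  rw [isPhaseShift_iff hα hp h]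
  simp [h0, h1, hp.ne']

/-! ### Perturbation of the zero-energy solution -/

namespace IsDecayingSolution

variable {α E : ℝ} {P P' Q Q' : ℝ → ℝ}

theorem const_mul (h : IsDecayingSolution α E P P') {c : ℝ} (hc : c ≠ 0) :
    IsDecayingSolution α E (fun z => c * P z) (fun z => c * P' z) where
  hasDeriv z hz := (h.hasDeriv z hz).const_mul c
  hasDeriv' z hz := ((h.hasDeriv' z hz).const_mul c).congr_deriv (by ring)
  vanishes := by simpa using h.vanishes.const_mul c
  nontrivial := by
    obtain ⟨z, hz, hne⟩ := h.nontrivial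
    exact ⟨z, hz, mul_ne_zero hc hne⟩

/-- For energies close to zero, `P P' + g P²` with a suitable weight `g` increases at a rate
controlling `P²`. -/
theorem exists_energy (hα : 1 ≤ α) (hE : E ≤ 1 / 256) (h : IsDecayingSolution α E P P') :
    ∃ G G' : ℝ → ℝ, ContinuousOn G (Ici 0) ∧ (∀ z, 0 < z → HasDerivAt G (G' z) z) ∧
      (∀ z, 0 < z → P z ^ 2 / 512 ≤ G' z) ∧ G 0 = P 0 * P' 0 + P 0 ^ 2 / 16 ∧
      ∀ᶠ z in atTop, G z ≤ P z ^ 2 := by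
  -- Completing the square gives `G' = (P' + g P)² + (z^α - E + g' - g²) P²`, so `g' - g²` must
  -- supply positivity where `z^α` is small. On `[0, 1]` it is at least `7/1024`, which absorbs `E ≤
  -- 1/256` and leaves more than `1/512`; beyond `1` the term `z^α ≥ 1` suffices.
  let g : ℝ → ℝ := fun z => 1 / 8 - 1 / 16 * (1 + z)⁻¹
  let g' : ℝ → ℝ := fun z => 1 / 16 * ((1 + z)⁻¹) ^ 2
  have hg : ∀ z, 0 ≤ z → HasDerivAt g (g' z) z := by
    intro z hz
    have h1 : 1 + z ≠ 0 := by positivity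
    refine (((((hasDerivAt_id z).const_add 1).inv h1).const_mul (1 / 16)).const_sub
      (1 / 8)).congr_deriv ?_
    simp only [g', id]
    field_simp
  have hgc : ContinuousOn g (Ici 0) := fun z hz => (hg z hz).continuousAt.continuousWithinAt
  have hinv : ∀ z : ℝ, 0 ≤ z → 0 < (1 + z)⁻¹ ∧ (1 + z)⁻¹ ≤ 1 := fun z hz =>
    ⟨by positivity, inv_le_one_of_one_le₀ (by linarith)⟩
  have hcoef : ∀ z, 0 < z → 1 / 512 ≤ z ^ α - E + g' z - g z ^ 2 := by
    intro z hz
    obtain ⟨i0, i1⟩ := hinv z hz.le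
    simp only [g, g']
    rcases le_total z 1 with hz1 | hz1
    · have i2 : (1 : ℝ) / 2 ≤ (1 + z)⁻¹ := by
        rw [one_div]
        exact inv_anti₀ (by linarith) (by linarith)
      have := Real.rpow_nonneg hz.le α
      nlinarith
    · have := Real.one_le_rpow hz1 (by linarith : 0 ≤ α)
      nlinarith
  refine ⟨fun z => P z * P' z + g z * (P z * P z), fun z =>
    P' z * P' z + P z * ((z ^ α - E) * P z) +
      (g' z * (P z * P z) + g z * (P' z * P z + P z * P' z)), ?_, ?_, ?_, ?_, ?_⟩
  · exact (h.continuousOn.mul h.continuousOn').add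
      (hgc.mul (h.continuousOn.mul h.continuousOn))
  · intro z hz
    have h1 := h.isSolutionBeyond.hasDerivAt z hz
    have h2 := h.isSolutionBeyond.hasDerivAt' z hz
    exact (h1.mul h2).add ((hg z hz.le).mul (h1.mul h1))
  · intro z hz
    have h1 := mul_le_mul_of_nonneg_right (hcoef z hz) (sq_nonneg (P z))
    nlinarith [sq_nonneg (P' z + g z * P z)]
  · simp only [g]
    norm_num
    ring
  · obtain ⟨b, hb⟩ := eventually_atTop.1 (eventually_nonneg_rpow_sub hα E)
    filter_upwards [eventually_gt_atTop (max 0 b)] with z hz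
    have h1 := (h.isSolutionBeyond.mono (le_max_left 0 b)).mul_deriv_nonpos
      (fun z hz => hb z ((le_max_right 0 b).trans hz.le)) h.vanishes hz
    have hz0 : 0 < z := (le_max_left 0 b).trans_lt hz
    obtain ⟨i0, i1⟩ := hinv z hz0.le
    have h2 : g z ≤ 1 := by simp only [g]; linarith
    nlinarith [mul_le_mul_of_nonneg_right h2 (mul_self_nonneg (P z))]

theorem energy_zero_nonpos (hα : 1 ≤ α) (hE : E ≤ 1 / 256) (h : IsDecayingSolution α E P P') :
    P 0 * P' 0 + P 0 ^ 2 / 16 ≤ 0 := by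
  obtain ⟨G, G', hc, hd, hG', hG0, hG⟩ := h.exists_energy hα hE
  have hm := monotoneOn_Ici_of_hasDerivAt hc hd fun z hz =>
    (by positivity : 0 ≤ P z ^ 2 / 512).trans (hG' z hz)
  have hlim : Tendsto (fun z => P z ^ 2) atTop (𝓝 0) := by simpa using h.vanishes.pow 2
  rw [← hG0]
  refine ge_of_tendsto hlim ?_
  filter_upwards [hG, eventually_ge_atTop 0] with z hz hz0
  exact (hm self_mem_Ici hz0 hz0).trans hz

theorem deriv_zero_ne_zero (hα : 1 ≤ α) (hE : E ≤ 1 / 256) (h : IsDecayingSolution α E P P') :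
    P' 0 ≠ 0 := by
  intro h0
  have h1 := h.energy_zero_nonpos hα hE
  rw [h0] at h1
  exact h.initial_ne_zero hα (by nlinarith) h0

/-- Divided by `P'(0)²`, the energy inequality at `0` reads `m (16 - m) ≥ 0`. -/
theorem ratio_mem_Icc (hα : 1 ≤ α) (hE : E ≤ 1 / 256) (h : IsDecayingSolution α E P P') :
    -(P 0 / P' 0) ∈ Icc (0 : ℝ) 16 := by
  have h0 := h.deriv_zero_ne_zero hα hE
  have h1 := h.energy_zero_nonpos hα hE
  set m := -(P 0 / P' 0) with hm
  have hP : P 0 = -(m * P' 0) := by rw [hm]; field_simp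
  have h2 : 0 < P' 0 ^ 2 := by positivity
  rw [hP] at h1
  have h3 : P' 0 ^ 2 * (m * (16 - m)) ≥ 0 := by nlinarith
  have h4 : 0 ≤ m * (16 - m) := nonneg_of_mul_nonneg_right h3 h2
  constructor <;> nlinarith

/-- The Wronskian `W` has derivative `E P Q`, and `|P Q| ≤ (P² + Q²)/2 ≤ 256 (G' + H')`. Hence `±W +
256 E (G + H)` increases, and it is eventually bounded by a function tending to `0`, so it is
nonpositive at `0`. -/
theorem abs_wronskian_zero_le (hα : 1 ≤ α) (hE0 : 0 ≤ E) (hE : E ≤ 1 / 256)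
    (hP : IsDecayingSolution α E P P') (hQ : IsDecayingSolution α 0 Q Q') :
    |P 0 * Q' 0 - P' 0 * Q 0| ≤ 256 * E * (-(P 0 * P' 0) - Q 0 * Q' 0) := by
  obtain ⟨G, G', hc, hd, hG', hG0, hG⟩ := hP.exists_energy hα hE
  obtain ⟨H, H', kc, kd, hH', hH0, hH⟩ := hQ.exists_energy hα (by norm_num)
  have hlimP : Tendsto (fun z => P z ^ 2) atTop (𝓝 0) := by simpa using hP.vanishes.pow 2
  have hlimQ : Tendsto (fun z => Q z ^ 2) atTop (𝓝 0) := by simpa using hQ.vanishes.pow 2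
  have hW := hP.tendsto_wronskian hα hQ
  have hWc := hP.continuousOn_wronskian hQ
  have hWd : ∀ z, 0 < z → HasDerivAt (fun z => P z * Q' z - P' z * Q z) (E * (P z * Q z)) z :=
    fun z hz => (hP.isSolutionBeyond.hasDerivAt_wronskian hQ.isSolutionBeyond hz).congr_deriv
      (by ring)
  have key : ∀ s : ℝ, s ^ 2 = 1 →
      s * (P 0 * Q' 0 - P' 0 * Q 0) ≤ 256 * E * (-(P 0 * P' 0) - Q 0 * Q' 0) := by
    intro s hs
    have hm := monotoneOn_Ici_of_hasDerivAt
      ((hWc.const_smul s).add ((hc.add kc).const_smul (256 * E)))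
      (fun z hz => ((hWd z hz).const_smul s).add
        (((hd z hz).add (kd z hz)).const_smul (256 * E))) (fun z hz => by
        have h1 := hG' z hz
        have h2 := hH' z hz
        have h3 : 0 ≤ E * (G' z + H' z - (P z ^ 2 + Q z ^ 2) / 512) :=
          mul_nonneg hE0 (by linarith)
        have h4 : 0 ≤ E * (P z + s * Q z) ^ 2 := mul_nonneg hE0 (sq_nonneg _)
        have h5 : (P z + s * Q z) ^ 2 = P z ^ 2 + Q z ^ 2 + 2 * (s * (P z * Q z)) := by
          linear_combination (Q z ^ 2) * hs
        rw [h5] at h4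
        simp only [smul_eq_mul]
        nlinarith)
    have hlim : Tendsto (fun z => s * (P z * Q' z - P' z * Q z) +
        256 * E * (P z ^ 2 + Q z ^ 2)) atTop (𝓝 0) := by
      simpa using (hW.const_mul s).add ((hlimP.add hlimQ).const_mul (256 * E))
    have hfin : s * (P 0 * Q' 0 - P' 0 * Q 0) + 256 * E * (G 0 + H 0) ≤ 0 := by
      refine ge_of_tendsto hlim ?_
      filter_upwards [hG, hH, eventually_ge_atTop 0] with z h1 h2 hz0
      have h3 := hm self_mem_Ici hz0 hz0
      simp only [Pi.add_apply, Pi.smul_apply, smul_eq_mul] at h3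
      refine h3.trans ?_
      gcongr
    rw [hG0, hH0] at hfin
    nlinarith [mul_nonneg hE0 (sq_nonneg (P 0)), mul_nonneg hE0 (sq_nonneg (Q 0))]
  rw [abs_le']
  exact ⟨by simpa using key 1 (by norm_num), by simpa using key (-1) (by norm_num)⟩

theorem abs_ratio_sub_ratio_le (hα : 1 ≤ α) (hE0 : 0 ≤ E) (hE : E ≤ 1 / 256)
    (hP : IsDecayingSolution α E P P') (hQ : IsDecayingSolution α 0 Q Q') :
    |P 0 / P' 0 - Q 0 / Q' 0| ≤ 8192 * E := by
  have p0 := hP.deriv_zero_ne_zero hα hE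
  have q0 := hQ.deriv_zero_ne_zero hα (by norm_num)
  have hp := (hP.ratio_mem_Icc hα hE).2
  have hq := (hQ.ratio_mem_Icc hα (by norm_num)).2
  -- With both slopes at `0` normalized to `1`, the Wronskian is the difference of ratios and the
  -- bound is `256 E (16 + 16)`.
  have h := (hP.const_mul (inv_ne_zero p0)).abs_wronskian_zero_le hα hE0 hE
    (hQ.const_mul (inv_ne_zero q0))
  simp only [inv_mul_cancel₀ p0, inv_mul_cancel₀ q0, mul_one, one_mul, inv_mul_eq_div] at h
  refine h.trans ?_
  nlinarith

end IsDecayingSolution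

/-! ### From the ratio at the origin to the phase shift -/

theorem abs_arctan_sub_le {x : ℝ} (hx : 0 ≤ x) : |Real.arctan x - x| ≤ x ^ 3 := by
  have hd : ∀ y : ℝ, 0 < y → HasDerivAt (fun y => y - Real.arctan y) (1 - 1 / (1 + y ^ 2)) y :=
    fun y _ => (hasDerivAt_id y).sub (Real.hasDerivAt_arctan y)
  have hval : ∀ y : ℝ, 1 - 1 / (1 + y ^ 2) = y ^ 2 / (1 + y ^ 2) := fun y => by
    field_simp
    ring
  have hc : Continuous fun y => y - Real.arctan y := continuous_id.sub Real.continuous_arctan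
  have h1 := monotoneOn_Ici_of_hasDerivAt (a := 0) hc.continuousOn hd (fun y _ => by
    rw [hval]
    positivity) self_mem_Ici hx hx
  have h2 := monotoneOn_Ici_of_hasDerivAt (a := 0) (F := fun y => y ^ 3 - (y - Real.arctan y))
    ((continuous_pow 3).sub hc).continuousOn
    (fun y hy => (hasDerivAt_pow 3 y).sub (hd y hy)) (fun y _ => by
      rw [hval]
      have : y ^ 2 / (1 + y ^ 2) ≤ y ^ 2 := div_le_self (sq_nonneg y) (by nlinarith)
      norm_num
      nlinarith) self_mem_Ici hx hx
  simp at h1 h2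
  rw [abs_le]
  constructor <;> linarith

/-- From `tan d = p m`, `d` and `arctan (p m)` differ by a multiple of `π`. The constant is `4096 +
8192`: the arctangent error is at most `(16 p)³`, and replacing `m` by `c` costs `p · 8192 p²`. -/
theorem exists_int_abs_phaseShift_sub_le {α c p d : ℝ} {Q Q' : ℝ → ℝ} (hα : 1 ≤ α)
    (hQ : IsDecayingSolution α 0 Q Q') (hc : -(Q 0 / Q' 0) = c) (hp : 0 < p) (hp' : p < 1 / 16)
    (hd : IsPhaseShift α p d) : ∃ n : ℤ, |d - n * Real.pi - c * p| ≤ 12288 * p ^ 3 := by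
  obtain ⟨P, P', hP⟩ := exists_isDecayingSolution hα (p ^ 2)
  have hE : p ^ 2 ≤ 1 / 256 := by nlinarith
  obtain ⟨hcos, htan⟩ :=
    (isPhaseShift_iff_tan hα hp hP (hP.deriv_zero_ne_zero hα hE)).1 hd
  obtain ⟨m0, m1⟩ := hP.ratio_mem_Icc hα hE
  have hW := hP.abs_ratio_sub_ratio_le hα (sq_nonneg p) hE hQ
  set m := -(P 0 / P' 0) with hm
  have htan' : Real.tan d = p * m := by rw [htan, hm]; ring
  have hmc : |m - c| ≤ 8192 * p ^ 2 := by
    rw [← hc, hm, ← abs_neg]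
    convert hW using 2
    ring
  have ha : Real.cos (Real.arctan (p * m)) ≠ 0 := (Real.cos_arctan_pos _).ne'
  have hsin : Real.sin (d - Real.arctan (p * m)) = 0 := by
    have h1 := Real.tan_arctan (p * m)
    rw [Real.tan_eq_sin_div_cos, div_eq_iff ha] at h1
    rw [Real.tan_eq_sin_div_cos, div_eq_iff hcos] at htan'
    rw [Real.sin_sub, h1, htan']
    ring
  obtain ⟨n, hn⟩ := Real.sin_eq_zero_iff.1 hsin
  refine ⟨n, ?_⟩
  have h1 := abs_arctan_sub_le (mul_nonneg hp.le m0)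
  have h2 : d - n * Real.pi - c * p =
      (Real.arctan (p * m) - p * m) + p * (m - c) := by
    rw [hn]
    ring
  rw [h2]
  refine (abs_add_le _ _).trans ?_
  rw [abs_mul, abs_of_pos hp]
  have h3 : (p * m) ^ 3 ≤ 4096 * p ^ 3 := by
    have : (p * m) ^ 3 ≤ (p * 16) ^ 3 := by gcongr
    linarith
  have h4 := mul_le_mul_of_nonneg_left hmc hp.le
  nlinarith

theorem isBigO_principalPhaseShift {α c C p₀ : ℝ} (hp₀ : 0 < p₀)
    (h : ∀ p : ℝ, 0 < p → p < p₀ → ∀ d : ℝ, IsPhaseShift α p d →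
        ∃ n : ℤ, |d - n * Real.pi - c * p| ≤ C * p ^ 3)
    {δ : ℝ → ℝ} (hδ : IsPrincipalPhaseShift α δ) :
    (fun p => δ p - c * p) =O[𝓝[>] (0 : ℝ)] fun p => p ^ 3 := by
  refine IsBigO.of_bound C ?_
  -- Together with `|δ p| ≤ π/2` this forces `|n π| < π`, so the integer is `0`.
  have hsmall : ∀ᶠ p in 𝓝[>] (0 : ℝ), C * p ^ 3 + |c * p| < Real.pi / 2 := by
    have hcont : Continuous fun p : ℝ => C * p ^ 3 + |c * p| := by fun_prop
    have := (hcont.tendsto 0).mono_left (nhdsWithin_le_nhds (s := Ioi 0))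
    refine this.eventually (gt_mem_nhds ?_)
    simp [Real.pi_pos]
  filter_upwards [hδ, hsmall, Ioo_mem_nhdsGT hp₀] with p ⟨h1, h2⟩ h3 h4
  obtain ⟨n, hn⟩ := h p h4.1 h4.2 _ h1
  have hn0 : n = 0 := by
    by_contra hne
    have hone : (1 : ℝ) ≤ |(n : ℝ)| := by
      exact_mod_cast Int.one_le_abs hne
    have hpi := Real.pi_pos
    have h5 : |(n : ℝ) * Real.pi| < Real.pi := by
      have h6 : |δ p| ≤ Real.pi / 2 := abs_le.2 ⟨h2.1.le, h2.2⟩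
      have h7 : (n : ℝ) * Real.pi = δ p - c * p - (δ p - n * Real.pi - c * p) := by ring
      rw [h7]
      have h8 := abs_sub (δ p - c * p) (δ p - n * Real.pi - c * p)
      have h9 := abs_sub (δ p) (c * p)
      linarith
    rw [abs_mul, abs_of_pos hpi] at h5
    nlinarith
  rw [hn0] at hn
  rw [Real.norm_eq_abs, Real.norm_of_nonneg (pow_nonneg h4.1.le 3)]
  simpa using hn

theorem isEquivalent_principalPhaseShift {c : ℝ} (hc : c ≠ 0) {δ : ℝ → ℝ}
    (h : (fun p => δ p - c * p) =O[𝓝[>] (0 : ℝ)] fun p => p ^ 3) :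
    δ ~[𝓝[>] (0 : ℝ)] fun p => c * p := by
  have h1 : (fun p : ℝ => p ^ 3) =o[𝓝[>] (0 : ℝ)] fun p => p := by
    have : (fun p : ℝ => p ^ 3) =o[𝓝 (0 : ℝ)] fun p => p ^ 1 :=
      isLittleO_pow_pow (by norm_num)
    simpa using this.mono nhdsWithin_le_nhds
  exact h.trans_isLittleO (h1.const_mul_right hc)

/-! ### The modified Bessel function and the zero-energy solution -/

/-- The integral `∫₀^∞ s^(μ-1) exp(-s - y/s) ds`, which equals `2 y^(μ/2) K_μ(2 √y)`. -/
noncomputable def macdonaldIntegral (μ y : ℝ) : ℝ :=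
  ∫ s in Ioi (0 : ℝ), s ^ (μ - 1) * Real.exp (-s - y / s)

section Macdonald

open MeasureTheory

theorem measurable_macdonald_integrand (μ y : ℝ) :
    Measurable fun s : ℝ => s ^ (μ - 1) * Real.exp (-s - y / s) := by fun_prop

theorem integrableOn_rpow_mul_exp_neg {μ : ℝ} (hμ : 0 < μ) :
    IntegrableOn (fun s : ℝ => s ^ (μ - 1) * Real.exp (-s)) (Ioi 0) :=
  (Real.GammaIntegral_convergent hμ).congr_fun (fun _ _ => mul_comm _ _) measurableSet_Ioi

theorem norm_macdonald_integrand_le {μ y s : ℝ} (hy : 0 ≤ y) (hs : 0 < s) :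
    ‖s ^ (μ - 1) * Real.exp (-s - y / s)‖ ≤ s ^ (μ - 1) * Real.exp (-s) := by
  rw [Real.norm_of_nonneg (by positivity)]
  gcongr
  have : 0 ≤ y / s := by positivity
  linarith

/-- For `μ ≤ 0` the singularity at `s = 0` is tamed by `exp (-y/s) ≤ k! (s/y)^k` with `k > -μ`.
Differentiation in `y` lowers `μ` by one, so all real `μ` are needed. -/
theorem integrableOn_macdonald_of_pos (μ : ℝ) {y : ℝ} (hy : 0 < y) :
    IntegrableOn (fun s : ℝ => s ^ (μ - 1) * Real.exp (-s - y / s)) (Ioi 0) := by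
  obtain ⟨k, hk⟩ := exists_nat_gt (-μ)
  have hdom : IntegrableOn (fun s : ℝ => k.factorial / y ^ k *
      (s ^ (μ + k - 1) * Real.exp (-s))) (Ioi 0) :=
    (integrableOn_rpow_mul_exp_neg (by linarith)).const_mul _
  refine hdom.mono' (measurable_macdonald_integrand μ y).aestronglyMeasurable ?_
  refine (ae_restrict_iff' measurableSet_Ioi).2 (ae_of_all _ fun s (hs : 0 < s) => ?_)
  rw [Real.norm_of_nonneg (by positivity)]
  have h1 := Real.pow_div_factorial_le_exp (x := y / s) (by positivity) k
  have h2 : Real.exp (-(y / s)) ≤ k.factorial / y ^ k * s ^ k := by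
    rw [Real.exp_neg]
    refine (inv_anti₀ (by positivity) h1).trans (le_of_eq ?_)
    rw [div_pow]
    field_simp
  have h3 : s ^ (μ + k - 1) = s ^ (μ - 1) * s ^ k := by
    rw [← Real.rpow_natCast, ← Real.rpow_add hs]
    congr 1
    ring
  rw [sub_eq_add_neg (-s), Real.exp_add, h3]
  calc s ^ (μ - 1) * (Real.exp (-s) * Real.exp (-(y / s)))
      ≤ s ^ (μ - 1) * (Real.exp (-s) * (k.factorial / y ^ k * s ^ k)) := by gcongr
    _ = _ := by ring

theorem hasDerivAt_macdonaldIntegral (μ : ℝ) {y : ℝ} (hy : 0 < y) :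
    HasDerivAt (macdonaldIntegral μ) (-macdonaldIntegral (μ - 1) y) y := by
  have key := (hasDerivAt_integral_of_dominated_loc_of_deriv_le (μ := volume.restrict (Ioi 0))
    (F := fun y s : ℝ => s ^ (μ - 1) * Real.exp (-s - y / s))
    (F' := fun y s : ℝ => -(s ^ (μ - 1 - 1) * Real.exp (-s - y / s)))
    (bound := fun s : ℝ => s ^ (μ - 1 - 1) * Real.exp (-s - y / 2 / s))
    (s := Ioi (y / 2)) (x₀ := y) (Ioi_mem_nhds (by linarith))
    (Eventually.of_forall fun y => (measurable_macdonald_integrand μ y).aestronglyMeasurable)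
    (integrableOn_macdonald_of_pos μ hy)
    (measurable_macdonald_integrand (μ - 1) y).neg.aestronglyMeasurable
    ((ae_restrict_iff' measurableSet_Ioi).2 (ae_of_all _ fun s (hs : 0 < s) x hx => ?_))
    (integrableOn_macdonald_of_pos (μ - 1) (half_pos hy))
    ((ae_restrict_iff' measurableSet_Ioi).2 (ae_of_all _ fun s (hs : 0 < s) x _ => ?_))).2
  · rw [integral_neg] at key
    exact key
  · rw [norm_neg, Real.norm_of_nonneg (by positivity)]
    have : y / 2 / s ≤ x / s := by
      have : y / 2 ≤ x := le_of_lt hx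
      gcongr
    gcongr
  · refine ((((hasDerivAt_id x).div_const s).const_sub (-s)).exp.const_mul
      (s ^ (μ - 1))).congr_deriv ?_
    rw [Real.rpow_sub_one hs.ne' (μ - 1)]
    simp only [id]
    ring

/-- The substitution `s ↦ y/s`, carried out as an inversion and a scaling. It is the symmetry
`K_{-μ} = K_μ`. -/
theorem macdonaldIntegral_neg (μ : ℝ) {y : ℝ} (hy : 0 < y) :
    macdonaldIntegral (-μ) y = y ^ (-μ) * macdonaldIntegral μ y := by
  have h1 := integral_comp_rpow_Ioi
    (fun s : ℝ => s ^ (-μ - 1) * Real.exp (-s - y / s)) (p := -1) (by norm_num)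
  have h2 := integral_comp_mul_left_Ioi
    (fun s : ℝ => s ^ (μ - 1) * Real.exp (-s - y / s)) 0 hy
  rw [mul_zero] at h2
  have h3 : ∫ s in Ioi (0 : ℝ), (y * s) ^ (μ - 1) * Real.exp (-(y * s) - y / (y * s)) =
      y ^ (μ - 1) * ∫ s in Ioi (0 : ℝ), s ^ (μ - 1) * Real.exp (-(y * s) - 1 / s) := by
    rw [← integral_const_mul]
    refine setIntegral_congr_fun measurableSet_Ioi fun s (hs : 0 < s) => ?_
    rw [Real.mul_rpow hy.le hs.le, mul_assoc, show y / (y * s) = 1 / s by field_simp]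
  rw [h3] at h2
  rw [macdonaldIntegral, ← h1]
  have h4 : ∫ s in Ioi (0 : ℝ), (|(-1 : ℝ)| * s ^ ((-1 : ℝ) - 1)) •
      ((s ^ (-1 : ℝ)) ^ (-μ - 1) * Real.exp (-s ^ (-1 : ℝ) - y / s ^ (-1 : ℝ))) =
      ∫ s in Ioi (0 : ℝ), s ^ (μ - 1) * Real.exp (-(y * s) - 1 / s) := by
    refine setIntegral_congr_fun measurableSet_Ioi fun s (hs : 0 < s) => ?_
    rw [← Real.rpow_mul hs.le, smul_eq_mul, ← mul_assoc, abs_neg, abs_one, one_mul,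
      ← Real.rpow_add hs, Real.rpow_neg_one]
    congr 2
    · ring
    · field_simp
      ring
  rw [h4, macdonaldIntegral]
  rw [smul_eq_mul] at h2
  rw [Real.rpow_neg hy.le]
  rw [Real.rpow_sub_one hy.ne'] at h2
  field_simp at h2 ⊢
  linarith

theorem tendsto_macdonaldIntegral_zero {μ : ℝ} (hμ : 0 < μ) :
    Tendsto (macdonaldIntegral μ) (𝓝[>] 0) (𝓝 (Real.Gamma μ)) := by
  have hG : Real.Gamma μ = ∫ s in Ioi (0 : ℝ), s ^ (μ - 1) * Real.exp (-s) := by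
    rw [Real.Gamma_eq_integral hμ]
    simp only [mul_comm]
  rw [hG]
  refine tendsto_integral_filter_of_dominated_convergence
    (fun s => s ^ (μ - 1) * Real.exp (-s))
    (Eventually.of_forall fun y => (measurable_macdonald_integrand μ y).aestronglyMeasurable)
    ?_ (integrableOn_rpow_mul_exp_neg hμ) (ae_of_all _ fun s => ?_)
  · filter_upwards [self_mem_nhdsWithin] with y hy
    exact (ae_restrict_iff' measurableSet_Ioi).2 (ae_of_all _ fun s hs =>
      norm_macdonald_integrand_le (le_of_lt hy) hs)
  · have hc : Continuous fun y : ℝ => s ^ (μ - 1) * Real.exp (-s - y / s) := by fun_prop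
    simpa using (hc.tendsto 0).mono_left nhdsWithin_le_nhds

theorem tendsto_macdonaldIntegral_atTop {μ : ℝ} (hμ : 0 < μ) :
    Tendsto (macdonaldIntegral μ) atTop (𝓝 0) := by
  have h0 : (0 : ℝ) = ∫ _ in Ioi (0 : ℝ), (0 : ℝ) := by simp
  rw [h0]
  refine tendsto_integral_filter_of_dominated_convergence
    (fun s => s ^ (μ - 1) * Real.exp (-s))
    (Eventually.of_forall fun y => (measurable_macdonald_integrand μ y).aestronglyMeasurable)
    ?_ (integrableOn_rpow_mul_exp_neg hμ)
    ((ae_restrict_iff' measurableSet_Ioi).2 (ae_of_all _ fun s (hs : 0 < s) => ?_))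
  · filter_upwards [eventually_ge_atTop 0] with y hy
    exact (ae_restrict_iff' measurableSet_Ioi).2 (ae_of_all _ fun s hs =>
      norm_macdonald_integrand_le hy hs)
  · have h1 : Tendsto (fun y : ℝ => -s - y / s) atTop atBot := by
      simp only [sub_eq_add_neg]
      exact tendsto_atBot_add_const_left _ _
        (tendsto_neg_atTop_atBot.comp (tendsto_id.atTop_div_const hs))
    simpa using (Real.tendsto_exp_atBot.comp h1).const_mul (s ^ (μ - 1))

theorem macdonaldIntegral_pos (μ : ℝ) {y : ℝ} (hy : 0 < y) : 0 < macdonaldIntegral μ y := by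
  refine (setIntegral_pos_iff_support_of_nonneg_ae ?_ (integrableOn_macdonald_of_pos μ hy)).2 ?_
  · refine (ae_restrict_iff' measurableSet_Ioi).2 (ae_of_all _ fun s (hs : 0 < s) => ?_)
    simp only [Pi.zero_apply]
    positivity
  · have : Ioi (0 : ℝ) ⊆
        Function.support (fun s : ℝ => s ^ (μ - 1) * Real.exp (-s - y / s)) ∩ Ioi 0 :=
      fun s (hs : 0 < s) => ⟨(by positivity : 0 < s ^ (μ - 1) * Real.exp (-s - y / s)).ne', hs⟩
    exact lt_of_lt_of_le (by simp) (measure_mono this)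

/-- The substitution `s = (x/2) e^t` gives an integral over the whole line of `exp (-x cosh t + ν
t)`; folding `t` with `-t` produces `cosh (ν t)`. -/
theorem besselK_eq_macdonaldIntegral (ν : ℝ) {x : ℝ} (hx : 0 < x) :
    besselK ν x = (x / 2) ^ (-ν) / 2 * macdonaldIntegral ν (x ^ 2 / 4) := by
  set b := x / 2 with hb
  have hbpos : 0 < b := half_pos hx
  have hy : x ^ 2 / 4 = b ^ 2 := by rw [hb]; ring
  rw [hy]
  let f : ℝ → ℝ := fun s => s ^ (ν - 1) * Real.exp (-s - b ^ 2 / s)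
  let g : ℝ → ℝ := fun s => f (b * s)
  have hf : IntegrableOn f (Ioi 0) := integrableOn_macdonald_of_pos ν (by positivity)
  have hg : IntegrableOn g (Ioi 0) := by
    have := (integrableOn_Ioi_comp_mul_left_iff f 0 hbpos).2 (by simpa using hf)
    simpa using this
  have hgint : ∫ s in Ioi (0 : ℝ), g s = b⁻¹ * macdonaldIntegral ν (b ^ 2) := by
    have := integral_comp_mul_left_Ioi f 0 hbpos
    rwa [mul_zero, smul_eq_mul] at this
  have himage : Real.exp '' univ = Ioi 0 := by rw [image_univ, Real.range_exp]
  have hd : ∀ t ∈ univ, HasDerivWithinAt Real.exp (Real.exp t) univ t := fun t _ =>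
    (Real.hasDerivAt_exp t).hasDerivWithinAt
  have hI := integral_image_eq_integral_abs_deriv_smul MeasurableSet.univ hd
    Real.exp_injective.injOn g
  have hII := (integrableOn_image_iff_integrableOn_abs_deriv_smul MeasurableSet.univ hd
    Real.exp_injective.injOn g).1 (by rwa [himage])
  let k : ℝ → ℝ := fun t => b ^ (ν - 1) * (Real.exp (-x * Real.cosh t) * Real.exp (ν * t))
  have hk : (fun t => |Real.exp t| • g (Real.exp t)) = k := by
    funext t
    simp only [g, f, k]
    rw [abs_of_pos (Real.exp_pos t), smul_eq_mul, Real.mul_rpow hbpos.le (Real.exp_pos t).le,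
      ← Real.exp_mul, Real.cosh_eq]
    have h1 : -(b * Real.exp t) - b ^ 2 / (b * Real.exp t) =
        -x * ((Real.exp t + Real.exp (-t)) / 2) := by
      rw [Real.exp_neg, hb]
      have := Real.exp_pos t
      field_simp
      ring
    rw [h1]
    have h2 : Real.exp (ν * t) = Real.exp t * Real.exp (t * (ν - 1)) := by
      rw [← Real.exp_add]
      ring_nf
    rw [h2]
    ring
  rw [himage, hgint, hk, setIntegral_univ] at hI
  rw [hk, integrableOn_univ] at hII
  have hsplit := intervalIntegral.integral_Iic_add_Ioi (b := (0 : ℝ)) hII.integrableOn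
    hII.integrableOn
  have hneg := integral_comp_neg_Ioi 0 k
  rw [neg_zero] at hneg
  have hIIn : IntegrableOn (fun t => k (-t)) (Ioi 0) := hII.comp_neg.integrableOn
  have hK : besselK ν x * (2 * b ^ (ν - 1)) = ∫ t in Ioi (0 : ℝ), (k (-t) + k t) := by
    rw [besselK, ← integral_mul_const]
    refine setIntegral_congr_fun measurableSet_Ioi fun t _ => ?_
    simp only [k]
    rw [Real.cosh_neg, Real.cosh_eq (ν * t), mul_neg]
    ring
  rw [integral_add hIIn hII.integrableOn, hneg, hsplit, ← hI] at hK
  have hbν : b ^ (ν - 1) = b ^ ν / b := Real.rpow_sub_one hbpos.ne' ν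
  rw [hbν] at hK
  rw [Real.rpow_neg hbpos.le]
  have hbp : 0 < b ^ ν := Real.rpow_pos_of_pos hbpos ν
  field_simp at hK ⊢
  linarith

end Macdonald

/-- The zero-energy solution for the exponent `α = 1/ν - 2`, up to a constant factor. -/
noncomputable def zeroEnergySolution (ν z : ℝ) : ℝ :=
  macdonaldIntegral ν (ν ^ 2 * z ^ (1 / ν))

/-- The derivative of `zeroEnergySolution`. -/
noncomputable def zeroEnergySolution' (ν z : ℝ) : ℝ :=
  -(ν ^ (2 * ν - 1) * macdonaldIntegral (1 - ν) (ν ^ 2 * z ^ (1 / ν)))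

theorem hasDerivAt_sq_mul_rpow {ν z : ℝ} (hν : 0 < ν) (hz : 0 < z) :
    HasDerivAt (fun z : ℝ => ν ^ 2 * z ^ (1 / ν)) (ν * z ^ (1 / ν - 1)) z := by
  refine ((Real.hasDerivAt_rpow_const (Or.inl hz.ne')).const_mul (ν ^ 2)).congr_deriv ?_
  field_simp

theorem sq_mul_rpow_rpow {ν z : ℝ} (hν : 0 < ν) (hz : 0 < z) (s : ℝ) :
    (ν ^ 2 * z ^ (1 / ν)) ^ s = ν ^ (2 * s) * z ^ (s / ν) := by
  rw [Real.mul_rpow (by positivity) (by positivity), ← Real.rpow_mul hz.le,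
    ← Real.rpow_natCast ν 2, ← Real.rpow_mul hν.le]
  congr 2
  ring

/-- Each differentiation lowers the index by one and the reflection `μ ↦ -μ` restores it: `ν → ν - 1
→ 1 - ν → -ν → ν`. The powers of `z` from reflection and chain rule cancel in the first derivative
and leave `z^(1/ν - 2)` in the second. -/
theorem isSolutionBeyond_zeroEnergySolution {ν : ℝ} (hν : 0 < ν) :
    IsSolutionBeyond (fun z => z ^ (1 / ν - 2)) (zeroEnergySolution ν) (zeroEnergySolution' ν) 0 := by
  constructor
  · intro z hz
    have hy : 0 < ν ^ 2 * z ^ (1 / ν) := by positivity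
    refine ((hasDerivAt_macdonaldIntegral ν hy).comp z
      (hasDerivAt_sq_mul_rpow hν hz)).congr_deriv ?_
    rw [zeroEnergySolution', ← neg_sub 1 ν, macdonaldIntegral_neg _ hy, neg_sub,
      sq_mul_rpow_rpow hν hz]
    have h1 : ν ^ (2 * (ν - 1)) * ν = ν ^ (2 * ν - 1) := by
      rw [← Real.rpow_add_one hν.ne']
      congr 1
      ring
    have h2 : z ^ ((ν - 1) / ν) * z ^ (1 / ν - 1) = 1 := by
      rw [← Real.rpow_add hz, show (ν - 1) / ν + (1 / ν - 1) = 0 by field_simp; ring,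
        Real.rpow_zero]
    rw [← h1]
    linear_combination (-(ν ^ (2 * (ν - 1)) * ν *
      macdonaldIntegral (1 - ν) (ν ^ 2 * z ^ (1 / ν)))) * h2
  · intro z hz
    have hy : 0 < ν ^ 2 * z ^ (1 / ν) := by positivity
    refine (((hasDerivAt_macdonaldIntegral (1 - ν) hy).comp z
      (hasDerivAt_sq_mul_rpow hν hz)).const_mul (ν ^ (2 * ν - 1))).neg.congr_deriv ?_
    rw [zeroEnergySolution, show 1 - ν - 1 = -ν by ring, macdonaldIntegral_neg _ hy,
      sq_mul_rpow_rpow hν hz]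
    have h1 : ν ^ (2 * -ν) * (ν ^ (2 * ν - 1) * ν) = 1 := by
      rw [← Real.rpow_add_one hν.ne', ← Real.rpow_add hν, ← Real.rpow_zero ν]
      congr 1
      ring
    have h2 : z ^ (-ν / ν) * z ^ (1 / ν - 1) = z ^ (1 / ν - 2) := by
      rw [← Real.rpow_add hz]
      congr 1
      field_simp
      ring
    rw [← h2]
    linear_combination (z ^ (-ν / ν) * z ^ (1 / ν - 1) *
      macdonaldIntegral ν (ν ^ 2 * z ^ (1 / ν))) * h1

theorem tendsto_zeroEnergySolution_atTop {ν : ℝ} (hν : 0 < ν) :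
    Tendsto (zeroEnergySolution ν) atTop (𝓝 0) :=
  (tendsto_macdonaldIntegral_atTop hν).comp
    ((tendsto_rpow_atTop (by positivity)).const_mul_atTop (by positivity))

theorem tendsto_sq_mul_rpow_nhdsGT {ν : ℝ} (hν : 0 < ν) :
    Tendsto (fun z : ℝ => ν ^ 2 * z ^ (1 / ν)) (𝓝[>] 0) (𝓝[>] 0) := by
  refine tendsto_nhdsWithin_iff.2 ⟨?_, ?_⟩
  · have hc : Continuous fun z : ℝ => ν ^ 2 * z ^ (1 / ν) :=
      continuous_const.mul (Real.continuous_rpow_const (by positivity))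
    have := (hc.tendsto 0).mono_left (nhdsWithin_le_nhds (s := Ioi 0))
    rwa [Real.zero_rpow (by positivity), mul_zero] at this
  · filter_upwards [self_mem_nhdsWithin] with z (hz : 0 < z)
    exact mul_pos (by positivity) (Real.rpow_pos_of_pos hz _)

theorem zeroEnergySolution_eq_besselK {ν z : ℝ} (hν : 0 < ν) (hz : 0 < z) :
    z ^ (1 / 2 : ℝ) * besselK ν (2 * ν * z ^ (1 / ν / 2)) =
      ν ^ (-ν) / 2 * zeroEnergySolution ν z := by
  rw [besselK_eq_macdonaldIntegral ν (by positivity), zeroEnergySolution]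
  have h1 : (2 * ν * z ^ (1 / ν / 2)) ^ 2 / 4 = ν ^ 2 * z ^ (1 / ν) := by
    have : (z ^ (1 / ν / 2)) ^ 2 = z ^ (1 / ν) := by
      rw [← Real.rpow_natCast, ← Real.rpow_mul hz.le]
      congr 1
      push_cast
      ring
    rw [mul_pow, this]
    ring
  have h2 : z ^ (1 / 2 : ℝ) * (2 * ν * z ^ (1 / ν / 2) / 2) ^ (-ν) = ν ^ (-ν) := by
    rw [show 2 * ν * z ^ (1 / ν / 2) / 2 = ν * z ^ (1 / ν / 2) by ring,
      Real.mul_rpow hν.le (by positivity), ← Real.rpow_mul hz.le, mul_left_comm,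
      ← Real.rpow_add hz]
    have : 1 / 2 + 1 / ν / 2 * -ν = 0 := by
      field_simp
      ring
    rw [this, Real.rpow_zero, mul_one]
  rw [h1, ← h2]
  ring

namespace IsDecayingSolution

variable {α : ℝ} {P P' : ℝ → ℝ}

theorem wronskian_zeroEnergySolution (hα : 1 ≤ α) (h : IsDecayingSolution α 0 P P') {z : ℝ}
    (hz : 0 < z) :
    P z * zeroEnergySolution' (1 / (α + 2)) z - P' z * zeroEnergySolution (1 / (α + 2)) z = 0 := by
  have hν : 0 < 1 / (α + 2) := by positivity
  have hB := isSolutionBeyond_zeroEnergySolution hν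
  rw [show (fun z : ℝ => z ^ (1 / (1 / (α + 2)) - 2)) = fun z => z ^ α - 0 by
    funext z; rw [one_div_one_div, add_sub_cancel_right, sub_zero]] at hB
  exact h.isSolutionBeyond.wronskian_eq_zero hB (eventually_nonneg_rpow_sub hα 0) h.vanishes
    (tendsto_zeroEnergySolution_atTop hν) hz

theorem eq_const_mul_besselK (hα : 1 ≤ α) (h : IsDecayingSolution α 0 P P') :
    ∃ c : ℝ, c ≠ 0 ∧ ∀ z : ℝ, 0 < z → P z = c * (z ^ (1 / 2 : ℝ) *
      besselK (1 / (α + 2)) (2 / (α + 2) * z ^ ((α + 2) / 2))) := by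
  have hν : 0 < 1 / (α + 2) := by positivity
  have hW := fun z hz => h.wronskian_zeroEnergySolution hα (z := z) hz
  have hK := fun z hz => zeroEnergySolution_eq_besselK hν (z := z) hz
  rw [one_div_one_div, mul_one_div] at hK
  set ν := 1 / (α + 2) with hνdef
  have hBpos : ∀ z, 0 < z → 0 < zeroEnergySolution ν z := fun z hz =>
    macdonaldIntegral_pos ν (by positivity)
  have hd : ∀ z, 0 < z → HasDerivAt (fun z => P z / zeroEnergySolution ν z) 0 z := fun z hz => by
    refine ((h.isSolutionBeyond.hasDerivAt z hz).div
      ((isSolutionBeyond_zeroEnergySolution hν).hasDerivAt z hz) (hBpos z hz).ne').congr_deriv ?_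
    rw [div_eq_zero_iff]
    left
    linarith [hW z hz]
  have hconst : ∀ z, 0 < z →
      P z = P 1 / zeroEnergySolution ν 1 * zeroEnergySolution ν z := by
    intro z hz
    have hm := monotoneOn_Ioi_of_hasDerivAt hd fun _ _ => le_rfl
    have ha := antitoneOn_Ioi_of_hasDerivAt hd fun _ _ => le_rfl
    have key : P z / zeroEnergySolution ν z = P 1 / zeroEnergySolution ν 1 := by
      rcases le_total z 1 with h1 | h1
      · exact le_antisymm (hm hz (mem_Ioi.2 one_pos) h1) (ha hz (mem_Ioi.2 one_pos) h1)
      · exact le_antisymm (ha (mem_Ioi.2 one_pos) hz h1) (hm (mem_Ioi.2 one_pos) hz h1)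
    rw [← key]
    field_simp [(hBpos z hz).ne']
  set c := P 1 / zeroEnergySolution ν 1
  have hc : c ≠ 0 := by
    intro hc
    have h1 : ∀ z, 0 < z → P z = 0 := fun z hz => by rw [hconst z hz, hc, zero_mul]
    have h2 : P 0 = 0 := by
      have ht : Tendsto P (𝓝[>] 0) (𝓝 (P 0)) :=
        (h.continuousOn 0 self_mem_Ici).mono_left (nhdsWithin_mono _ Ioi_subset_Ici_self)
      refine tendsto_nhds_unique ht (tendsto_const_nhds.congr' ?_)
      filter_upwards [self_mem_nhdsWithin] with z hz
      exact (h1 z hz).symm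
    obtain ⟨z, hz, hne⟩ := h.nontrivial
    rcases hz.eq_or_lt with rfl | hz
    · exact hne h2
    · exact hne (h1 z hz)
  refine ⟨c * (2 * ν ^ ν), by positivity, fun z hz => ?_⟩
  rw [hK z hz, hconst z hz, Real.rpow_neg hν.le]
  have : 0 < ν ^ ν := Real.rpow_pos_of_pos hν ν
  field_simp

/-- The Wronskian with the explicit solution vanishes for `z > 0`. Letting `z → 0+`, where that
solution and its derivative tend to `Γ(ν)` and `-ν^(2ν-1) Γ(1-ν)`, gives the ratio; `ν Γ(ν) =
Γ(ν+1)` brings it to the stated form. -/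
theorem ratio_eq_phaseSlope (hα : 1 ≤ α) (h : IsDecayingSolution α 0 P P') :
    -(P 0 / P' 0) = phaseSlope α := by
  have hν : 0 < 1 / (α + 2) := by positivity
  have hW := fun z hz => h.wronskian_zeroEnergySolution hα (z := z) hz
  have hP0 := h.deriv_zero_ne_zero hα (by norm_num)
  have e1 : (α + 3) / (α + 2) = 1 / (α + 2) + 1 := by field_simp; ring
  have e2 : (α + 1) / (α + 2) = 1 - 1 / (α + 2) := by field_simp; ring
  have e3 : (α + 2) ^ (2 / (α + 2)) = (1 / (α + 2)) ^ (-(2 * (1 / (α + 2)))) := by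
    rw [one_div, Real.inv_rpow (by linarith), Real.rpow_neg (by linarith), inv_inv]
    congr 1
  rw [phaseSlope, e1, e2, e3]
  have hν1 : 1 / (α + 2) < 1 := by
    rw [div_lt_one (by linarith)]
    linarith
  set ν := 1 / (α + 2) with hνdef
  have hlimB : Tendsto (zeroEnergySolution ν) (𝓝[>] 0) (𝓝 (Real.Gamma ν)) :=
    (tendsto_macdonaldIntegral_zero hν).comp (tendsto_sq_mul_rpow_nhdsGT hν)
  have hlimB' : Tendsto (zeroEnergySolution' ν) (𝓝[>] 0)
      (𝓝 (-(ν ^ (2 * ν - 1) * Real.Gamma (1 - ν)))) :=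
    (((tendsto_macdonaldIntegral_zero (by linarith)).comp
      (tendsto_sq_mul_rpow_nhdsGT hν)).const_mul _).neg
  have hlimP : Tendsto P (𝓝[>] 0) (𝓝 (P 0)) :=
    (h.continuousOn 0 self_mem_Ici).mono_left (nhdsWithin_mono _ Ioi_subset_Ici_self)
  have hlimP' : Tendsto P' (𝓝[>] 0) (𝓝 (P' 0)) :=
    (h.continuousOn' 0 self_mem_Ici).mono_left (nhdsWithin_mono _ Ioi_subset_Ici_self)
  have hlim : P 0 * -(ν ^ (2 * ν - 1) * Real.Gamma (1 - ν)) - P' 0 * Real.Gamma ν = 0 := by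
    refine tendsto_nhds_unique ((hlimP.mul hlimB').sub (hlimP'.mul hlimB))
      (tendsto_const_nhds.congr' ?_)
    filter_upwards [self_mem_nhdsWithin] with z hz
    exact (hW z hz).symm
  have hG1 : 0 < Real.Gamma (1 - ν) := Real.Gamma_pos_of_pos (by linarith)
  have hp : 0 < ν ^ (2 * ν) := Real.rpow_pos_of_pos hν _
  rw [Real.Gamma_add_one hν.ne', Real.rpow_neg hν.le]
  rw [Real.rpow_sub_one hν.ne'] at hlim
  field_simp at hlim ⊢
  linarith

end IsDecayingSolution

theorem phaseSlope_pos {α : ℝ} (hα : 1 ≤ α) : 0 < phaseSlope α :=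
  div_pos (mul_pos (Real.rpow_pos_of_pos (by linarith) _)
    (Real.Gamma_pos_of_pos (by positivity))) (Real.Gamma_pos_of_pos (by positivity))

/-! ### The Airy function -/

section Airy

open MeasureTheory

/-- The integral `∫₀^∞ rⁿ exp(-r³/3 - x r e^{iπ/3}) dr`. -/
noncomputable def airyMoment (n : ℕ) (x : ℝ) : ℂ :=
  ∫ r in Ioi (0 : ℝ), (r : ℂ) ^ n *
    Complex.exp (-(r : ℂ) ^ 3 / 3 - x * (r * Complex.exp (Complex.I * (Real.pi / 3))))

theorem exp_I_mul_pi_div_three :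
    Complex.exp (Complex.I * (Real.pi / 3)) = ⟨1 / 2, √3 / 2⟩ := by
  rw [mul_comm, show ((Real.pi : ℂ) / 3) = ((Real.pi / 3 : ℝ) : ℂ) by push_cast; ring,
    Complex.exp_mul_I, ← Complex.ofReal_cos, ← Complex.ofReal_sin, Real.cos_pi_div_three,
    Real.sin_pi_div_three]
  apply Complex.ext <;> simp

theorem exp_I_mul_pi_div_three_cube : Complex.exp (Complex.I * (Real.pi / 3)) ^ 3 = -1 := by
  rw [← Complex.exp_nat_mul, ← Complex.exp_pi_mul_I]
  congr 1
  push_cast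
  ring

theorem norm_airy_integrand (n : ℕ) (x : ℝ) {r : ℝ} (hr : 0 ≤ r) :
    ‖(r : ℂ) ^ n *
      Complex.exp (-(r : ℂ) ^ 3 / 3 - x * (r * Complex.exp (Complex.I * (Real.pi / 3))))‖ =
      r ^ n * Real.exp (-r ^ 3 / 3 - x * r / 2) := by
  rw [norm_mul, norm_pow, Complex.norm_real, Real.norm_of_nonneg hr, Complex.norm_exp,
    exp_I_mul_pi_div_three]
  congr 2
  have h1 : -(r : ℂ) ^ 3 / 3 - x * (r * ⟨1 / 2, √3 / 2⟩) =
      ((-r ^ 3 / 3 : ℝ) : ℂ) - ((x * r : ℝ) : ℂ) * ⟨1 / 2, √3 / 2⟩ := by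
    push_cast
    ring
  rw [h1, Complex.sub_re, Complex.ofReal_re, Complex.re_ofReal_mul]
  ring

theorem norm_airy_integrand_le (n : ℕ) {x R r : ℝ} (hR : 0 ≤ R) (hx : -R ≤ x) (hr : 0 ≤ r) :
    ‖(r : ℂ) ^ n *
      Complex.exp (-(r : ℂ) ^ 3 / 3 - x * (r * Complex.exp (Complex.I * (Real.pi / 3))))‖ ≤
      Real.exp (2 / 3 * (R + 1) ^ 3) * (r ^ n * Real.exp (-r)) := by
  rw [norm_airy_integrand n x hr, mul_left_comm, ← Real.exp_add]
  gcongr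
  -- This product equals `r³ - 3 (R+1)² r + 2 (R+1)³`, so `r³/3 + (2/3)(R+1)³ ≥ (R+1)² r ≥ (R/2 + 1)
  -- r`.
  have h1 : 0 ≤ (r - (R + 1)) ^ 2 * (r + 2 * (R + 1)) := by positivity
  have h2 : 0 ≤ (x + R) * r := mul_nonneg (by linarith) hr
  nlinarith [mul_nonneg (mul_nonneg hR hR) hr, mul_nonneg hR hr]

theorem integrableOn_pow_mul_exp_neg (n : ℕ) :
    IntegrableOn (fun r : ℝ => r ^ n * Real.exp (-r)) (Ioi 0) := by
  refine (integrableOn_rpow_mul_exp_neg (μ := n + 1) (by positivity)).congr_fun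
    (fun s _ => ?_) measurableSet_Ioi
  simp

theorem measurable_airy_integrand (n : ℕ) (x : ℝ) : Measurable fun r : ℝ => (r : ℂ) ^ n *
      Complex.exp (-(r : ℂ) ^ 3 / 3 - x * (r * Complex.exp (Complex.I * (Real.pi / 3)))) := by
  have : Continuous fun r : ℝ => (r : ℂ) ^ n *
      Complex.exp (-(r : ℂ) ^ 3 / 3 - x * (r * Complex.exp (Complex.I * (Real.pi / 3)))) := by
    fun_prop
  exact this.measurable

theorem integrableOn_airy_integrand (n : ℕ) (x : ℝ) : IntegrableOn (fun r : ℝ => (r : ℂ) ^ n *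
      Complex.exp (-(r : ℂ) ^ 3 / 3 - x * (r * Complex.exp (Complex.I * (Real.pi / 3))))) (Ioi 0) :=
  ((integrableOn_pow_mul_exp_neg n).const_mul _).mono'
    (measurable_airy_integrand n x).aestronglyMeasurable
    ((ae_restrict_iff' measurableSet_Ioi).2 (ae_of_all _ fun _ hr =>
      norm_airy_integrand_le n (abs_nonneg x) (neg_abs_le x) (le_of_lt hr)))

theorem hasDerivAt_airyMoment (n : ℕ) (x : ℝ) :
    HasDerivAt (airyMoment n)
      (-Complex.exp (Complex.I * (Real.pi / 3)) * airyMoment (n + 1) x) x := by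
  set ω := Complex.exp (Complex.I * (Real.pi / 3)) with hω
  have hnorm : ‖-ω‖ = 1 := by
    rw [norm_neg, hω, mul_comm, show ((Real.pi : ℂ) / 3) = ((Real.pi / 3 : ℝ) : ℂ) by
      push_cast; ring, Complex.norm_exp_ofReal_mul_I]
  have key := (hasDerivAt_integral_of_dominated_loc_of_deriv_le (μ := volume.restrict (Ioi 0))
    (F := fun (x r : ℝ) => (r : ℂ) ^ n * Complex.exp (-(r : ℂ) ^ 3 / 3 - x * (r * ω)))
    (F' := fun (x r : ℝ) =>
      -ω * ((r : ℂ) ^ (n + 1) * Complex.exp (-(r : ℂ) ^ 3 / 3 - x * (r * ω))))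
    (bound := fun r : ℝ => Real.exp (2 / 3 * ((|x| + 1) + 1) ^ 3) *
      (r ^ (n + 1) * Real.exp (-r)))
    (s := Ioi (x - 1)) (x₀ := x) (Ioi_mem_nhds (by linarith))
    (Eventually.of_forall fun x => (measurable_airy_integrand n x).aestronglyMeasurable)
    (integrableOn_airy_integrand n x)
    ((measurable_airy_integrand (n + 1) x).const_mul (-ω)).aestronglyMeasurable
    ((ae_restrict_iff' measurableSet_Ioi).2 (ae_of_all _ fun r (hr : 0 < r) y hy => ?_))
    ((integrableOn_pow_mul_exp_neg (n + 1)).const_mul _)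
    ((ae_restrict_iff' measurableSet_Ioi).2 (ae_of_all _ fun r (hr : 0 < r) y _ => ?_))).2
  · rw [integral_const_mul] at key
    exact key
  · rw [norm_mul, hnorm, one_mul]
    refine norm_airy_integrand_le (n + 1) (by positivity) ?_ hr.le
    have h1 : x - 1 < y := hy
    have h2 := neg_abs_le x
    linarith
  · have h1 : HasDerivAt (fun y : ℝ => (y : ℂ)) 1 y := Complex.ofRealCLM.hasDerivAt
    refine (((h1.mul_const ((r : ℂ) * ω)).const_sub (-(r : ℂ) ^ 3 / 3)).cexp.const_mul
      ((r : ℂ) ^ n)).congr_deriv ?_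
    ring

/-- The integrand is minus the derivative of the exponential itself, which runs from `1` at `r = 0`
to `0` at infinity. -/
theorem airyMoment_two_add (x : ℝ) :
    airyMoment 2 x + x * Complex.exp (Complex.I * (Real.pi / 3)) * airyMoment 0 x = 1 := by
  set ω := Complex.exp (Complex.I * (Real.pi / 3)) with hω
  have hd : ∀ r ∈ Ici (0 : ℝ), HasDerivAt
      (fun r : ℝ => -((r : ℂ) ^ 0 * Complex.exp (-(r : ℂ) ^ 3 / 3 - x * (r * ω))))
      ((r : ℂ) ^ 2 * Complex.exp (-(r : ℂ) ^ 3 / 3 - x * (r * ω)) +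
        x * ω * ((r : ℂ) ^ 0 * Complex.exp (-(r : ℂ) ^ 3 / 3 - x * (r * ω)))) r := by
    intro r _
    have h1 : HasDerivAt (fun y : ℝ => (y : ℂ)) 1 r := Complex.ofRealCLM.hasDerivAt
    simp only [pow_zero, one_mul]
    refine (((((h1.pow 3).neg).div_const 3).sub
      ((h1.mul_const ω).const_mul (x : ℂ))).cexp.neg).congr_deriv ?_
    simp only [Pi.pow_apply, Pi.neg_apply, Pi.sub_apply]
    push_cast
    ring
  have hlim : Tendsto
      (fun r : ℝ => -((r : ℂ) ^ 0 * Complex.exp (-(r : ℂ) ^ 3 / 3 - x * (r * ω)))) atTop (𝓝 0) := by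
    have h0 : Tendsto (fun r : ℝ => Real.exp (2 / 3 * (|x| + 1) ^ 3) * (r ^ 0 * Real.exp (-r)))
        atTop (𝓝 0) := by
      simpa using (Real.tendsto_exp_atBot.comp tendsto_neg_atTop_atBot).const_mul
        (Real.exp (2 / 3 * (|x| + 1) ^ 3))
    refine squeeze_zero_norm' ?_ h0
    filter_upwards [eventually_ge_atTop 0] with r hr
    rw [norm_neg]
    exact norm_airy_integrand_le 0 (abs_nonneg x) (neg_abs_le x) hr
  have h := integral_Ioi_of_hasDerivAt_of_tendsto' hd
    ((integrableOn_airy_integrand 2 x).add ((integrableOn_airy_integrand 0 x).const_mul _)) hlim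
  rw [integral_add (integrableOn_airy_integrand 2 x)
    ((integrableOn_airy_integrand 0 x).const_mul _), integral_const_mul] at h
  simpa [airyMoment] using h

theorem tendsto_airyMoment_zero : Tendsto (airyMoment 0) atTop (𝓝 0) := by
  have h0 : (0 : ℂ) = ∫ _ in Ioi (0 : ℝ), (0 : ℂ) := by simp
  rw [h0]
  refine tendsto_integral_filter_of_dominated_convergence
    (fun r => Real.exp (2 / 3 * (0 + 1) ^ 3) * (r ^ 0 * Real.exp (-r)))
    (Eventually.of_forall fun x => (measurable_airy_integrand 0 x).aestronglyMeasurable)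
    ?_ ((integrableOn_pow_mul_exp_neg 0).const_mul _)
    ((ae_restrict_iff' measurableSet_Ioi).2 (ae_of_all _ fun r (hr : 0 < r) => ?_))
  · filter_upwards [eventually_ge_atTop 0] with x hx
    exact (ae_restrict_iff' measurableSet_Ioi).2 (ae_of_all _ fun r hr =>
      norm_airy_integrand_le 0 le_rfl (by simpa using hx) (le_of_lt hr))
  · rw [tendsto_zero_iff_norm_tendsto_zero]
    simp only [norm_airy_integrand 0 _ hr.le]
    have h1 : Tendsto (fun x : ℝ => -r ^ 3 / 3 - x * r / 2) atTop atBot := by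
      simp only [sub_eq_add_neg]
      exact tendsto_atBot_add_const_left _ _ (tendsto_neg_atTop_atBot.comp
        ((tendsto_id.atTop_mul_const hr).atTop_div_const two_pos))
    simp only [pow_zero, one_mul]
    exact Real.tendsto_exp_atBot.comp h1

theorem airyAi_eq (x : ℝ) :
    airyAi x = 1 / Real.pi *
      (Complex.exp (Complex.I * (Real.pi / 3)) * airyMoment 0 x).im := by
  rw [airyAi, airyMoment, ← integral_const_mul]
  simp only [pow_zero, one_mul]

theorem hasDerivAt_airyAi (x : ℝ) :
    HasDerivAt airyAi (1 / Real.pi *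
      (-Complex.exp (Complex.I * (Real.pi / 3)) ^ 2 * airyMoment 1 x).im) x := by
  rw [show airyAi = fun x => 1 / Real.pi *
      (Complex.exp (Complex.I * (Real.pi / 3)) * airyMoment 0 x).im from funext airyAi_eq]
  have h := (Complex.imCLM.hasFDerivAt.comp_hasDerivAt x
    ((hasDerivAt_airyMoment 0 x).const_mul (Complex.exp (Complex.I * (Real.pi / 3)))))
  refine (h.const_mul (1 / Real.pi)).congr_deriv ?_
  rw [Complex.imCLM_apply]
  congr 2
  ring

theorem hasDerivAt_deriv_airyAi (x : ℝ) : HasDerivAt (deriv airyAi) (x * airyAi x) x := by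
  rw [show deriv airyAi = fun x => 1 / Real.pi *
      (-Complex.exp (Complex.I * (Real.pi / 3)) ^ 2 * airyMoment 1 x).im from
    funext fun x => (hasDerivAt_airyAi x).deriv]
  have h := (Complex.imCLM.hasFDerivAt.comp_hasDerivAt x
    ((hasDerivAt_airyMoment 1 x).const_mul (-Complex.exp (Complex.I * (Real.pi / 3)) ^ 2)))
  refine (h.const_mul (1 / Real.pi)).congr_deriv ?_
  -- Since `ω³ = -1` for `ω = e^{iπ/3}`, the second derivative of `ω · airyMoment 0` is `-airyMoment
  -- 2`. The boundary term `1` is real and drops out of the imaginary part.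
  have h1 : -Complex.exp (Complex.I * (Real.pi / 3)) ^ 2 *
      (-Complex.exp (Complex.I * (Real.pi / 3)) * airyMoment (1 + 1) x) =
      ((x : ℝ) : ℂ) * (Complex.exp (Complex.I * (Real.pi / 3)) * airyMoment 0 x) - 1 := by
    linear_combination (airyMoment 2 x) * exp_I_mul_pi_div_three_cube - airyMoment_two_add x
  rw [h1, airyAi_eq, Complex.imCLM_apply, Complex.sub_im, Complex.im_ofReal_mul, Complex.one_im]
  ring

theorem airyAi_zero_pos : 0 < airyAi 0 := by
  have h0 : airyMoment 0 0 = ((∫ r in Ioi (0 : ℝ), Real.exp (-r ^ 3 / 3) : ℝ) : ℂ) := by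
    rw [airyMoment, ← integral_complex_ofReal]
    refine setIntegral_congr_fun measurableSet_Ioi fun r _ => ?_
    simp
  have hint : IntegrableOn (fun r : ℝ => Real.exp (-r ^ 3 / 3)) (Ioi 0) := by
    refine IntegrableOn.congr_fun (s := Ioi 0) (integrableOn_airy_integrand 0 0).norm
      (fun r hr => ?_) measurableSet_Ioi
    rw [norm_airy_integrand 0 0 (le_of_lt hr)]
    simp
  have hpos : 0 < ∫ r in Ioi (0 : ℝ), Real.exp (-r ^ 3 / 3) := by
    refine (setIntegral_pos_iff_support_of_nonneg_ae
      (ae_of_all _ fun r => (Real.exp_pos _).le) hint).2 ?_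
    have : Ioi (0 : ℝ) ⊆ Function.support (fun r : ℝ => Real.exp (-r ^ 3 / 3)) ∩ Ioi 0 :=
      fun r hr => ⟨(Real.exp_pos _).ne', hr⟩
    exact lt_of_lt_of_le (by simp) (measure_mono this)
  rw [airyAi_eq, h0, Complex.im_mul_ofReal, exp_I_mul_pi_div_three]
  have := Real.pi_pos
  positivity

theorem tendsto_airyAi_atTop : Tendsto airyAi atTop (𝓝 0) := by
  rw [show airyAi = fun x => 1 / Real.pi *
      (Complex.exp (Complex.I * (Real.pi / 3)) * airyMoment 0 x).im from funext airyAi_eq]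
  have h := (tendsto_airyMoment_zero.const_mul (Complex.exp (Complex.I * (Real.pi / 3))))
  rw [mul_zero] at h
  have h2 := ((Complex.continuous_im.tendsto 0).comp h).const_mul (1 / Real.pi)
  simpa using h2

/-- If `Ai` vanished on `[a, ∞)` with `a ≥ 0`, its Cauchy data at `a` would be zero; uniqueness for
the reflected equation carries this back to `0`, where `Ai` is positive. -/
theorem exists_airyAi_ne_zero (a : ℝ) : ∃ x, a ≤ x ∧ airyAi x ≠ 0 := by
  rcases le_total a 0 with ha | ha
  · exact ⟨0, ha, airyAi_zero_pos.ne'⟩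
  by_contra! h
  have hda : deriv airyAi a = 0 := by
    have h1 : HasDerivWithinAt airyAi 0 (Ici a) a :=
      (hasDerivWithinAt_const a (Ici a) (0 : ℝ)).congr (fun z hz => h z hz) (h a le_rfl)
    exact (uniqueDiffOn_Ici a a self_mem_Ici).eq_deriv _
      (hasDerivAt_airyAi a).differentiableAt.hasDerivAt.hasDerivWithinAt h1
  have hrefl : ∀ z : ℝ, HasDerivAt (fun z => a - z) (-1) z := fun z =>
    (hasDerivAt_id z).const_sub a
  have key := eq_zero_of_second_order (a := 0) (q := fun z => a - z)
    (f := fun z => airyAi (a - z)) (f' := fun z => deriv airyAi (a - z) * -1)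
    (by fun_prop)
    (fun z _ => (((hasDerivAt_airyAi (a - z)).differentiableAt.hasDerivAt).comp z
      (hrefl z)).hasDerivWithinAt)
    (fun z _ => ((((hasDerivAt_deriv_airyAi (a - z)).comp z (hrefl z)).mul_const
      (-1)).congr_deriv (by ring)).hasDerivWithinAt)
    (by simpa using h a le_rfl) (by simp [hda]) a ha
  simp only [sub_self] at key
  exact airyAi_zero_pos.ne' key.1

theorem isDecayingSolution_airyAi (E : ℝ) :
    IsDecayingSolution 1 E (fun z => airyAi (z - E)) (fun z => deriv airyAi (z - E)) where
  hasDeriv z _ :=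
    ((hasDerivAt_airyAi (z - E)).differentiableAt.hasDerivAt.comp_sub_const z E).hasDerivWithinAt
  hasDeriv' z _ := by
    rw [Real.rpow_one]
    exact ((hasDerivAt_deriv_airyAi (z - E)).comp_sub_const z E).hasDerivWithinAt
  vanishes := tendsto_airyAi_atTop.comp (tendsto_atTop_add_const_right _ _ tendsto_id)
  nontrivial := by
    obtain ⟨x, hx, hne⟩ := exists_airyAi_ne_zero (-E)
    exact ⟨x + E, by linarith, by simpa using hne⟩

end Airy

/-! ### The parabolic cylinder function -/

section ParabolicCylinder

open MeasureTheory Polynomial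

/-- The Hermite polynomials over the reals. -/
noncomputable def realHermite (n : ℕ) : ℝ[X] := (hermite n).map (algebraMap ℤ ℝ)

theorem realHermite_succ (n : ℕ) :
    realHermite (n + 1) = X * realHermite n - derivative (realHermite n) := by
  simp [realHermite, hermite_succ, derivative_map]

theorem derivative_realHermite_succ (n : ℕ) :
    derivative (realHermite (n + 1)) = C ((n : ℝ) + 1) * realHermite n := by
  induction n with
  | zero => simp [realHermite]
  | succ n ih =>
    rw [realHermite_succ (n + 1), derivative_sub, derivative_mul, ih, derivative_X,
      derivative_C_mul]
    have h := realHermite_succ n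
    push_cast
    simp only [C_add, C_1] at *
    linear_combination (-(C (n : ℝ) + 1)) * h

theorem eventually_realHermite_pos {n : ℕ} (hn : n ≠ 0) :
    ∀ᶠ x in atTop, 0 < (realHermite n).eval x := by
  have hmonic : (realHermite n).Monic := (hermite_monic n).map _
  have hdeg : 0 < (realHermite n).degree := by
    rw [realHermite, (hermite_monic n).degree_map, degree_hermite]
    exact_mod_cast Nat.pos_of_ne_zero hn
  exact (tendsto_atTop_of_leadingCoeff_nonneg _ hdeg
    (by rw [hmonic.leadingCoeff]; exact zero_le_one)).eventually_gt_atTop 0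

theorem exists_abs_eval_le_exp_abs (p : ℝ[X]) :
    ∃ K : ℝ, 0 ≤ K ∧ ∀ y, |p.eval y| ≤ K * Real.exp |y| := by
  induction p using Polynomial.induction_on' with
  | add p q hp hq =>
    obtain ⟨K, hK, hp⟩ := hp
    obtain ⟨M, hM, hq⟩ := hq
    refine ⟨K + M, by positivity, fun y => ?_⟩
    rw [eval_add, add_mul]
    exact (abs_add_le _ _).trans (add_le_add (hp y) (hq y))
  | monomial n a =>
    refine ⟨|a| * n.factorial, by positivity, fun y => ?_⟩
    rw [eval_monomial, abs_mul, abs_pow, mul_assoc]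
    have h := Real.pow_div_factorial_le_exp (x := |y|) (abs_nonneg y) n
    rw [div_le_iff₀' (by positivity)] at h
    gcongr

theorem exists_abs_eval_mul_exp_le (p : ℝ[X]) :
    ∃ K : ℝ, 0 ≤ K ∧ ∀ y, |p.eval y * Real.exp (-y ^ 2 / 2)| ≤
      K * Real.exp (-(3 / 8 * y ^ 2) - y) := by
  obtain ⟨K, hK, hp⟩ := exists_abs_eval_le_exp_abs p
  refine ⟨K * Real.exp 8, by positivity, fun y => ?_⟩
  rw [abs_mul, Real.abs_exp]
  calc |p.eval y| * Real.exp (-y ^ 2 / 2) ≤ K * Real.exp |y| * Real.exp (-y ^ 2 / 2) := by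
        gcongr
        exact hp y
    _ = K * Real.exp (|y| + -y ^ 2 / 2) := by rw [Real.exp_add, mul_assoc]
    _ ≤ K * Real.exp (8 + (-(3 / 8 * y ^ 2) - y)) := by
        refine mul_le_mul_of_nonneg_left (Real.exp_le_exp.2 ?_) hK
        -- From `(|y| - 8)² ≥ 0` one gets `2|y| ≤ 8 + y²/8`. The rate `3/8` exceeds the `1/4` of the
        -- prefactor `e^{x²/4}`, and the term `-y` supplies the factor `e^{-t}`.
        nlinarith [sq_nonneg (|y| - 8), sq_abs y, le_abs_self y]
    _ = _ := by rw [Real.exp_add, mul_assoc]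

/-- The integral `∫₀^∞ t^(s-1) p(x+t) exp(-(x+t)²/2) dt`. -/
noncomputable def weberIntegral (s : ℝ) (p : ℝ[X]) (x : ℝ) : ℝ :=
  ∫ t in Ioi (0 : ℝ), t ^ (s - 1) * (p.eval (x + t) * Real.exp (-(x + t) ^ 2 / 2))

theorem measurable_weber_integrand (s : ℝ) (p : ℝ[X]) (x : ℝ) :
    Measurable fun t : ℝ => t ^ (s - 1) * (p.eval (x + t) * Real.exp (-(x + t) ^ 2 / 2)) := by
  have : Continuous fun t : ℝ => p.eval (x + t) * Real.exp (-(x + t) ^ 2 / 2) :=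
    (p.continuous.comp (by fun_prop)).mul (by fun_prop)
  exact Measurable.mul (by fun_prop) this.measurable

theorem exists_norm_weber_integrand_le (p : ℝ[X]) :
    ∃ K : ℝ, 0 ≤ K ∧ ∀ s x t : ℝ, 0 < t →
      ‖t ^ (s - 1) * (p.eval (x + t) * Real.exp (-(x + t) ^ 2 / 2))‖ ≤
        K * Real.exp (-(3 / 8 * (x + t) ^ 2) - x) * (t ^ (s - 1) * Real.exp (-t)) := by
  obtain ⟨K, hK, hp⟩ := exists_abs_eval_mul_exp_le p
  refine ⟨K, hK, fun s x t ht => ?_⟩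
  rw [norm_mul, Real.norm_of_nonneg (by positivity), Real.norm_eq_abs]
  calc t ^ (s - 1) * |p.eval (x + t) * Real.exp (-(x + t) ^ 2 / 2)|
      ≤ t ^ (s - 1) * (K * Real.exp (-(3 / 8 * (x + t) ^ 2) - (x + t))) := by
        gcongr
        exact hp (x + t)
    _ = _ := by
        rw [show -(3 / 8 * (x + t) ^ 2) - (x + t) = -(3 / 8 * (x + t) ^ 2) - x + -t by ring,
          Real.exp_add]
        ring

theorem exists_norm_weber_integrand_le_of_le (p : ℝ[X]) (a : ℝ) :
    ∃ K : ℝ, 0 ≤ K ∧ ∀ s x t : ℝ, a ≤ x → 0 < t →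
      ‖t ^ (s - 1) * (p.eval (x + t) * Real.exp (-(x + t) ^ 2 / 2))‖ ≤
        K * (t ^ (s - 1) * Real.exp (-t)) := by
  obtain ⟨K, hK, hp⟩ := exists_norm_weber_integrand_le p
  refine ⟨K * Real.exp (-a), by positivity, fun s x t hx ht => (hp s x t ht).trans ?_⟩
  gcongr
  nlinarith [sq_nonneg (x + t)]

theorem integrableOn_weber_integrand {s : ℝ} (hs : 0 < s) (p : ℝ[X]) (x : ℝ) :
    IntegrableOn (fun t : ℝ => t ^ (s - 1) * (p.eval (x + t) * Real.exp (-(x + t) ^ 2 / 2)))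
      (Ioi 0) := by
  obtain ⟨K, -, hp⟩ := exists_norm_weber_integrand_le_of_le p x
  exact ((integrableOn_rpow_mul_exp_neg hs).const_mul K).mono'
    (measurable_weber_integrand s p x).aestronglyMeasurable
    ((ae_restrict_iff' measurableSet_Ioi).2 (ae_of_all _ fun t ht => hp s x t le_rfl ht))

theorem hasDerivAt_eval_mul_exp (p : ℝ[X]) (y : ℝ) :
    HasDerivAt (fun y => p.eval y * Real.exp (-y ^ 2 / 2))
      ((derivative p - X * p).eval y * Real.exp (-y ^ 2 / 2)) y := by
  have h1 : HasDerivAt (fun y : ℝ => -y ^ 2 / 2) (-y) y := by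
    refine ((hasDerivAt_pow 2 y).neg.div_const 2).congr_deriv ?_
    norm_num
    ring
  refine ((p.hasDerivAt y).mul h1.exp).congr_deriv ?_
  rw [eval_sub, eval_mul, eval_X]
  ring

theorem hasDerivAt_weberIntegral {s : ℝ} (hs : 0 < s) (p : ℝ[X]) (x : ℝ) :
    HasDerivAt (weberIntegral s p) (weberIntegral s (derivative p - X * p) x) x := by
  obtain ⟨K, -, hp⟩ := exists_norm_weber_integrand_le_of_le (derivative p - X * p) (x - 1)
  exact (hasDerivAt_integral_of_dominated_loc_of_deriv_le (μ := volume.restrict (Ioi 0))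
    (F := fun x t : ℝ => t ^ (s - 1) * (p.eval (x + t) * Real.exp (-(x + t) ^ 2 / 2)))
    (F' := fun x t : ℝ => t ^ (s - 1) *
      ((derivative p - X * p).eval (x + t) * Real.exp (-(x + t) ^ 2 / 2)))
    (bound := fun t : ℝ => K * (t ^ (s - 1) * Real.exp (-t)))
    (s := Ioi (x - 1)) (x₀ := x) (Ioi_mem_nhds (by linarith))
    (Eventually.of_forall fun x => (measurable_weber_integrand s p x).aestronglyMeasurable)
    (integrableOn_weber_integrand hs p x)
    (measurable_weber_integrand s _ x).aestronglyMeasurable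
    ((ae_restrict_iff' measurableSet_Ioi).2 (ae_of_all _ fun t ht y hy =>
      hp s y t (le_of_lt hy) ht))
    ((integrableOn_rpow_mul_exp_neg hs).const_mul K)
    (ae_of_all _ fun t y _ =>
      ((hasDerivAt_eval_mul_exp p (y + t)).comp_add_const y t).const_mul _)).2

theorem weberIntegral_sub {s : ℝ} (hs : 0 < s) (p q : ℝ[X]) (x : ℝ) :
    weberIntegral s (p - q) x = weberIntegral s p x - weberIntegral s q x := by
  rw [weberIntegral, weberIntegral, weberIntegral,
    ← integral_sub (integrableOn_weber_integrand hs p x) (integrableOn_weber_integrand hs q x)]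
  simp only [eval_sub]
  congr 1
  funext t
  ring

theorem weberIntegral_C_mul (s c : ℝ) (p : ℝ[X]) (x : ℝ) :
    weberIntegral s (C c * p) x = c * weberIntegral s p x := by
  rw [weberIntegral, weberIntegral, ← integral_const_mul]
  simp only [eval_mul, eval_C]
  congr 1
  funext t
  ring

theorem weberIntegral_X_mul {s : ℝ} (hs : 0 < s) (p : ℝ[X]) (x : ℝ) :
    weberIntegral s (X * p) x = x * weberIntegral s p x + weberIntegral (s + 1) p x := by
  rw [weberIntegral, weberIntegral, weberIntegral, ← integral_const_mul,
    ← integral_add ((integrableOn_weber_integrand hs p x).const_mul x)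
      (integrableOn_weber_integrand (by linarith) p x)]
  refine setIntegral_congr_fun measurableSet_Ioi fun t (ht : 0 < t) => ?_
  have h : t ^ (s + 1 - 1) = t ^ (s - 1) * t := by
    rw [← Real.rpow_add_one ht.ne']
    congr 1
    ring
  simp only [eval_mul, eval_X, h]
  ring

/-- The boundary term `t^s (…)` vanishes at `0` because `s > 0`. The derivative is needed only for
`t > 0`, as `t^(s-1)` may be singular at `0`. -/
theorem weberIntegral_by_parts {s : ℝ} (hs : 0 < s) (p : ℝ[X]) (x : ℝ) :
    s * weberIntegral s p x + weberIntegral (s + 1) (derivative p - X * p) x = 0 := by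
  have i1 := (integrableOn_weber_integrand hs p x).const_mul s
  have i2 := integrableOn_weber_integrand (s := s + 1) (by linarith) (derivative p - X * p) x
  have hcont : Continuous fun t : ℝ => t ^ s * (p.eval (x + t) * Real.exp (-(x + t) ^ 2 / 2)) :=
    (Real.continuous_rpow_const hs.le).mul ((p.continuous.comp (by fun_prop)).mul (by fun_prop))
  have hlim : Tendsto (fun t : ℝ => t ^ s * (p.eval (x + t) * Real.exp (-(x + t) ^ 2 / 2)))
      atTop (𝓝 0) := by
    obtain ⟨K, -, hp⟩ := exists_norm_weber_integrand_le_of_le p x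
    have h0 : Tendsto (fun t : ℝ => K * (t ^ (s + 1 - 1) * Real.exp (-t))) atTop (𝓝 0) := by
      have := (tendsto_rpow_mul_exp_neg_mul_atTop_nhds_zero (s + 1 - 1) 1 one_pos).const_mul K
      simpa using this
    refine squeeze_zero_norm' ?_ h0
    filter_upwards [eventually_gt_atTop 0] with t ht
    simpa using hp (s + 1) x t le_rfl ht
  have h := integral_Ioi_of_hasDerivAt_of_tendsto (a := 0) hcont.continuousAt.continuousWithinAt
    (f' := fun t => s * (t ^ (s - 1) * (p.eval (x + t) * Real.exp (-(x + t) ^ 2 / 2))) +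
      t ^ (s + 1 - 1) *
        (eval (x + t) (derivative p - X * p) * Real.exp (-(x + t) ^ 2 / 2)))
    (fun t (ht : 0 < t) => by
      refine ((Real.hasDerivAt_rpow_const (Or.inl ht.ne')).mul
        ((hasDerivAt_eval_mul_exp p (x + t)).comp_const_add x t)).congr_deriv ?_
      rw [add_sub_cancel_right]
      ring) (i1.add i2) hlim
  rw [integral_add i1 i2, integral_const_mul, Real.zero_rpow hs.ne'] at h
  rw [weberIntegral, weberIntegral, h]
  ring

/-- In `He_{n+2} = y He_{n+1} - (n+1) He_n` with `y = x + t`, the factor `t` raises `s` by one, and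
integration by parts turns that term into `s` times the integral with `He_n`. As differentiation in
`x` raises the Hermite index, this recurrence is a second-order equation in `x`. -/
theorem weberIntegral_realHermite_ode {s : ℝ} (hs : 0 < s) (n : ℕ) (x : ℝ) :
    weberIntegral s (realHermite (n + 2)) x = x * weberIntegral s (realHermite (n + 1)) x +
      (s - n - 1) * weberIntegral s (realHermite n) x := by
  have h1 := weberIntegral_by_parts hs (realHermite n) x
  have h2 : derivative (realHermite n) - X * realHermite n = 0 - realHermite (n + 1) := by
    rw [realHermite_succ]
    ring
  have h3 : weberIntegral (s + 1) 0 x = 0 := by simp [weberIntegral]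
  rw [h2, weberIntegral_sub (by linarith), h3] at h1
  rw [realHermite_succ (n + 1), derivative_realHermite_succ, weberIntegral_sub hs,
    weberIntegral_C_mul, weberIntegral_X_mul hs]
  linarith

theorem hasDerivAt_weberIntegral_realHermite {s : ℝ} (hs : 0 < s) (n : ℕ) (x : ℝ) :
    HasDerivAt (weberIntegral s (realHermite n)) (-weberIntegral s (realHermite (n + 1)) x) x := by
  refine (hasDerivAt_weberIntegral hs (realHermite n) x).congr_deriv ?_
  have h3 : weberIntegral s 0 x = 0 := by simp [weberIntegral]
  rw [show derivative (realHermite n) - X * realHermite n = 0 - realHermite (n + 1) by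
    rw [realHermite_succ]; ring, weberIntegral_sub hs, h3, zero_sub]

theorem tendsto_exp_mul_weberIntegral {s : ℝ} (hs : 0 < s) (p : ℝ[X]) :
    Tendsto (fun x => Real.exp (x ^ 2 / 4) * weberIntegral s p x) atTop (𝓝 0) := by
  obtain ⟨K, hK, hp⟩ := exists_norm_weber_integrand_le p
  have hG := integrableOn_rpow_mul_exp_neg hs
  set G := ∫ t in Ioi (0 : ℝ), t ^ (s - 1) * Real.exp (-t)
  have h0 : Tendsto (fun x : ℝ => Real.exp (-x) * (K * G)) atTop (𝓝 0) := by
    simpa using (Real.tendsto_exp_atBot.comp tendsto_neg_atTop_atBot).mul_const (K * G)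
  refine squeeze_zero_norm' ?_ h0
  filter_upwards [eventually_ge_atTop 0] with x hx
  have hle : ‖weberIntegral s p x‖ ≤ Real.exp (-(3 / 8 * x ^ 2) - x) * (K * G) := by
    rw [show Real.exp (-(3 / 8 * x ^ 2) - x) * (K * G) =
      ∫ t in Ioi (0 : ℝ), Real.exp (-(3 / 8 * x ^ 2) - x) *
        (K * (t ^ (s - 1) * Real.exp (-t))) by rw [integral_const_mul, integral_const_mul]]
    refine norm_integral_le_of_norm_le ((hG.const_mul K).const_mul _)
      ((ae_restrict_iff' measurableSet_Ioi).2 (ae_of_all _ fun t (ht : 0 < t) => ?_))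
    refine (hp s x t ht).trans ?_
    rw [mul_comm K, mul_assoc]
    gcongr
    linarith
  rw [norm_mul, Real.norm_of_nonneg (Real.exp_pos _).le]
  calc Real.exp (x ^ 2 / 4) * ‖weberIntegral s p x‖
      ≤ Real.exp (x ^ 2 / 4) * (Real.exp (-(3 / 8 * x ^ 2) - x) * (K * G)) := by gcongr
    _ = Real.exp (x ^ 2 / 4 + (-(3 / 8 * x ^ 2) - x)) * (K * G) := by
        rw [Real.exp_add, mul_assoc]
    _ ≤ Real.exp (-x) * (K * G) := by
        have hGpos : 0 ≤ G := setIntegral_nonneg measurableSet_Ioi fun t (ht : 0 < t) => by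
          positivity
        gcongr
        nlinarith [sq_nonneg x]

/-- For `x` beyond the last sign change of `He_n` the integrand is positive; this gives
nontriviality of `D_ν` on the half-line. -/
theorem exists_weberIntegral_realHermite_pos {s : ℝ} (hs : 0 < s) {n : ℕ} (hn : n ≠ 0) :
    ∃ x : ℝ, 0 ≤ x ∧ 0 < weberIntegral s (realHermite n) x := by
  obtain ⟨b, hb⟩ := eventually_atTop.1 (eventually_realHermite_pos hn)
  refine ⟨max 0 b, le_max_left _ _, ?_⟩
  have hpos : ∀ t : ℝ, 0 < t → 0 < t ^ (s - 1) * ((realHermite n).eval (max 0 b + t) *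
      Real.exp (-(max 0 b + t) ^ 2 / 2)) := fun t ht => by
    have := hb (max 0 b + t) (by linarith [le_max_right 0 b])
    positivity
  refine (setIntegral_pos_iff_support_of_nonneg_ae ?_ (integrableOn_weber_integrand hs _ _)).2 ?_
  · exact (ae_restrict_iff' measurableSet_Ioi).2 (ae_of_all _ fun t ht => (hpos t ht).le)
  · exact lt_of_lt_of_le (by simp : 0 < volume (Ioi (0 : ℝ)))
      (measure_mono fun t ht => ⟨(hpos t ht).ne', ht⟩)

theorem parabolicCylinderD_eq (ν x : ℝ) :
    parabolicCylinderD ν x = (Real.Gamma ((⌊ν⌋₊ + 1 : ℕ) - ν))⁻¹ * (Real.exp (x ^ 2 / 4) *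
      weberIntegral ((⌊ν⌋₊ + 1 : ℕ) - ν) (realHermite (⌊ν⌋₊ + 1)) x) := by
  simp only [parabolicCylinderD, weberIntegral, realHermite, eval_map_algebraMap]
  ring

theorem floor_add_one_sub_pos (ν : ℝ) : 0 < ((⌊ν⌋₊ + 1 : ℕ) : ℝ) - ν := by
  have := Nat.lt_floor_add_one ν
  push_cast
  linarith

theorem hasDerivAt_exp_sq_div_four (x : ℝ) :
    HasDerivAt (fun x : ℝ => Real.exp (x ^ 2 / 4)) (x / 2 * Real.exp (x ^ 2 / 4)) x := by
  refine ((hasDerivAt_pow 2 x).div_const 4).exp.congr_deriv ?_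
  norm_num
  ring

theorem hasDerivAt_parabolicCylinderD (ν x : ℝ) :
    HasDerivAt (parabolicCylinderD ν) ((Real.Gamma ((⌊ν⌋₊ + 1 : ℕ) - ν))⁻¹ *
      (Real.exp (x ^ 2 / 4) *
        (x / 2 * weberIntegral ((⌊ν⌋₊ + 1 : ℕ) - ν) (realHermite (⌊ν⌋₊ + 1)) x -
          weberIntegral ((⌊ν⌋₊ + 1 : ℕ) - ν) (realHermite (⌊ν⌋₊ + 2)) x))) x := by
  rw [funext (parabolicCylinderD_eq ν)]
  refine (((hasDerivAt_exp_sq_div_four x).mul (hasDerivAt_weberIntegral_realHermite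
    (floor_add_one_sub_pos ν) (⌊ν⌋₊ + 1) x)).const_mul _).congr_deriv ?_
  ring

theorem hasDerivAt_deriv_parabolicCylinderD (ν x : ℝ) :
    HasDerivAt (deriv (parabolicCylinderD ν)) ((x ^ 2 / 4 - ν - 1 / 2) * parabolicCylinderD ν x)
      x := by
  rw [funext fun x => (hasDerivAt_parabolicCylinderD ν x).deriv]
  have hs := floor_add_one_sub_pos ν
  have hode := weberIntegral_realHermite_ode hs (⌊ν⌋₊ + 1) x
  rw [parabolicCylinderD_eq]
  refine (((hasDerivAt_exp_sq_div_four x).mul ((((hasDerivAt_id x).div_const 2).mul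
    (hasDerivAt_weberIntegral_realHermite hs (⌊ν⌋₊ + 1) x)).sub
      (hasDerivAt_weberIntegral_realHermite hs (⌊ν⌋₊ + 2) x))).const_mul _).congr_deriv ?_
  simp only [id, Pi.sub_apply, Pi.mul_apply]
  rw [show ⌊ν⌋₊ + 1 + 1 = ⌊ν⌋₊ + 2 from rfl] at *
  rw [show ⌊ν⌋₊ + 1 + 2 = ⌊ν⌋₊ + 2 + 1 from rfl] at hode
  rw [hode]
  push_cast
  ring

/-- With `x = √2 z` and `ν = (E-1)/2`, the coefficient `2 (x²/4 - ν - 1/2)` is `z² - E`. -/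
theorem isDecayingSolution_parabolicCylinderD (E : ℝ) :
    IsDecayingSolution 2 E (fun z => parabolicCylinderD ((E - 1) / 2) (√2 * z))
      (fun z => √2 * deriv (parabolicCylinderD ((E - 1) / 2)) (√2 * z)) where
  hasDeriv z _ := by
    have h := (hasDerivAt_parabolicCylinderD ((E - 1) / 2) (√2 * z)).differentiableAt.hasDerivAt
    exact ((h.comp z ((hasDerivAt_id z).const_mul √2)).congr_deriv (by ring)).hasDerivWithinAt
  hasDeriv' z _ := by
    have h := hasDerivAt_deriv_parabolicCylinderD ((E - 1) / 2) (√2 * z)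
    refine (((h.comp z ((hasDerivAt_id z).const_mul √2)).const_mul √2).congr_deriv
      ?_).hasDerivWithinAt
    have h2 : √2 ^ 2 = (2 : ℝ) := Real.sq_sqrt zero_le_two
    rw [show z ^ (2 : ℝ) = z ^ 2 by exact_mod_cast Real.rpow_natCast z 2]
    linear_combination parabolicCylinderD ((E - 1) / 2) (√2 * z) *
      (z ^ 2 / 4 * (√2 ^ 2 + 2) - (E - 1) / 2 - 1 / 2) * h2
  vanishes := by
    have h := (tendsto_exp_mul_weberIntegral (floor_add_one_sub_pos ((E - 1) / 2))
      (realHermite (⌊(E - 1) / 2⌋₊ + 1))).const_mul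
        (Real.Gamma ((⌊(E - 1) / 2⌋₊ + 1 : ℕ) - (E - 1) / 2))⁻¹
    rw [mul_zero] at h
    simp only [← parabolicCylinderD_eq] at h
    exact h.comp (tendsto_id.const_mul_atTop (by positivity))
  nontrivial := by
    have hs := floor_add_one_sub_pos ((E - 1) / 2)
    obtain ⟨x, hx, hpos⟩ := exists_weberIntegral_realHermite_pos hs
      (Nat.succ_ne_zero ⌊(E - 1) / 2⌋₊)
    refine ⟨x / √2, by positivity, ?_⟩
    rw [mul_div_cancel₀ x (by positivity), parabolicCylinderD_eq]
    have hG := Real.Gamma_pos_of_pos hs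
    exact (mul_pos (inv_pos.2 hG) (mul_pos (Real.exp_pos _) hpos)).ne'

end ParabolicCylinder

/-! ### The main theorem -/

theorem mainTheorem3 :
    (∀ α : ℝ, 1 ≤ α →
      -- the solution vanishing at infinity exists and is unique up to a constant factor
      (∀ E : ℝ, ∃ P P' : ℝ → ℝ, IsDecayingSolution α E P P' ∧
        ∀ Q Q' : ℝ → ℝ, IsDecayingSolution α E Q Q' →
          ∃ c : ℝ, c ≠ 0 ∧ ∀ z : ℝ, 0 ≤ z → Q z = c * P z ∧ Q' z = c * P' z) ∧
      -- the zero-energy solution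
      (∀ P P' : ℝ → ℝ, IsDecayingSolution α 0 P P' →
        ∃ c : ℝ, c ≠ 0 ∧ ∀ z : ℝ, 0 < z →
          P z = c * (z ^ (1 / 2 : ℝ) *
            besselK (1 / (α + 2)) (2 / (α + 2) * z ^ ((α + 2) / 2)))) ∧
      -- existence of the phase shift, and its uniqueness modulo `π`
      (∀ p : ℝ, 0 < p →
        ∃ d ∈ Ioc (-(Real.pi / 2)) (Real.pi / 2),
          ∀ d' : ℝ, IsPhaseShift α p d' ↔ ∃ n : ℤ, d' = d + n * Real.pi) ∧
      -- the matching formula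
      (∀ p : ℝ, 0 < p → ∀ P P' : ℝ → ℝ, IsDecayingSolution α (p ^ 2) P P' →
        ∀ d : ℝ,
          (P' 0 ≠ 0 → (IsPhaseShift α p d ↔
            Real.cos d ≠ 0 ∧ Real.tan d = -p * (P 0 / P' 0))) ∧
          (P' 0 = 0 → (IsPhaseShift α p d ↔ Real.cos d = 0))) ∧
      -- small-`p` asymptotics, modulo `π` and uniformly over all determinations
      (∃ p₀ > 0, ∃ C : ℝ, ∀ p : ℝ, 0 < p → p < p₀ → ∀ d : ℝ, IsPhaseShift α p d →
        ∃ n : ℤ, |d - n * Real.pi - phaseSlope α * p| ≤ C * p ^ 3) ∧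
      -- small-`p` asymptotics of the principal branch
      (∀ δ : ℝ → ℝ, IsPrincipalPhaseShift α δ →
        (fun p => δ p - phaseSlope α * p) =O[𝓝[>] (0 : ℝ)] fun p => p ^ 3)) ∧
    -- the Airy case
    ((∀ E : ℝ, IsDecayingSolution 1 E (fun z => airyAi (z - E))
        (fun z => deriv airyAi (z - E))) ∧
      ∀ δ : ℝ → ℝ, IsPrincipalPhaseShift 1 δ →
        δ ~[𝓝[>] (0 : ℝ)] fun p =>
          p * ((3 : ℝ) ^ (2 / 3 : ℝ) * Real.Gamma (4 / 3) / Real.Gamma (2 / 3))) ∧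
    -- the parabolic cylinder case
    ((∀ E : ℝ, IsDecayingSolution 2 E (fun z => parabolicCylinderD ((E - 1) / 2) (√2 * z))
        (fun z => √2 * deriv (parabolicCylinderD ((E - 1) / 2)) (√2 * z))) ∧
      ∀ δ : ℝ → ℝ, IsPrincipalPhaseShift 2 δ →
        δ ~[𝓝[>] (0 : ℝ)] fun p => 2 * p * Real.Gamma (5 / 4) / Real.Gamma (3 / 4)) := by
  have hsmall : ∀ α : ℝ, 1 ≤ α → ∀ p : ℝ, 0 < p → p < 1 / 16 → ∀ d : ℝ, IsPhaseShift α p d →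
      ∃ n : ℤ, |d - n * Real.pi - phaseSlope α * p| ≤ 12288 * p ^ 3 := by
    intro α hα p hp hp' d hd
    obtain ⟨Q, Q', hQ⟩ := exists_isDecayingSolution hα 0
    exact exists_int_abs_phaseShift_sub_le hα hQ (hQ.ratio_eq_phaseSlope hα) hp hp' hd
  have hprincipal : ∀ α : ℝ, 1 ≤ α → ∀ δ : ℝ → ℝ, IsPrincipalPhaseShift α δ →
      (fun p => δ p - phaseSlope α * p) =O[𝓝[>] (0 : ℝ)] fun p => p ^ 3 :=
    fun α hα δ hδ => isBigO_principalPhaseShift (by norm_num) (hsmall α hα) hδ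
  refine ⟨fun α hα => ⟨fun E => ?_, fun P P' h => h.eq_const_mul_besselK hα,
    fun p hp => exists_phaseShift_iff hα hp, fun p hp P P' h d =>
      ⟨isPhaseShift_iff_tan hα hp h, isPhaseShift_iff_cos hα hp h⟩,
    ⟨1 / 16, by norm_num, 12288, hsmall α hα⟩, hprincipal α hα⟩,
    ⟨isDecayingSolution_airyAi, fun δ hδ => ?_⟩,
    ⟨isDecayingSolution_parabolicCylinderD, fun δ hδ => ?_⟩⟩
  · obtain ⟨P, P', h⟩ := exists_isDecayingSolution hα E
    exact ⟨P, P', h, fun Q Q' hQ => h.eq_const_mul hα hQ⟩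
  · have h := isEquivalent_principalPhaseShift (phaseSlope_pos le_rfl).ne'
      (hprincipal 1 le_rfl δ hδ)
    convert h using 2 with p
    rw [phaseSlope]
    norm_num
    ring
  · have h := isEquivalent_principalPhaseShift (phaseSlope_pos one_le_two).ne'
      (hprincipal 2 one_le_two δ hδ)
    convert h using 2 with p
    have h4 : (4 : ℝ) ^ (1 / 2 : ℝ) = 2 := by
      rw [← Real.sqrt_eq_rpow, show (4 : ℝ) = 2 ^ 2 by norm_num, Real.sqrt_sq zero_le_two]
    rw [phaseSlope, show (2 : ℝ) + 2 = 4 by norm_num, show (2 : ℝ) / 4 = 1 / 2 by norm_num, h4]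
    norm_num
    ring
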